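/- Fix $n\ge 2$. For multi-indices $\alpha,\beta\in\mathbb N^n$ put $|\alpha|=\alpha_1+\dots+\alpha_n$, $\|\phi\|_{\alpha,\beta}=\sup_{x\in\mathbb R^n}|x^\alpha\partial^\beta\phi(x)|$, and let $S_{\alpha,\beta}$ be the set of Schwartz functions $\phi:\mathbb R^n\to\mathbb C$ with $\|\phi\|_{\alpha',\beta'}\le 1$ for all $\alpha',\beta'\in\mathbb N^n$ with $|\alpha'|\le|\alpha|$, $|\beta'|\le|\beta|$. For $0<\delta<1$, $t>0$ and a function $\Upsilon$ on $\mathbb R^n$ put $\Upsilon_I(x)=\delta^{-(n-1)}\,\Upsilon(x_1/\delta,\dots,x_{n-1}/\delta,x_n)$ and $\Upsilon_{I_t}(x)=t^{-n}\,\Upsilon_I(x/t)$, and define $$M^t_{\delta S_{\alpha,\beta}}f(x)=\sup_{A\in O(n),\ \Upsilon\in S_{\alpha,\beta}}\left|\int_{\mathbb R^n}f(x-y)\,\Upsilon_{I_t}(A^{-1}y)\,dy\right|,$$ where $O(n)$ is the group of orthogonal $n\times n$ matrices. **Theorem 3.4.** Let $0<p<\infty$. For all $\alpha,\beta\in\mathbb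 N^n$ with $|\alpha|,|\beta|$ sufficiently large (depending only on $n$ and $p$) and every $\varepsilon>0$ there is a constant $C>0$, depending only on $\alpha,\beta,p,n,\varepsilon$, such that the following holds for all $0<r<p$, $0<\delta<1$ and $0<t\le\delta^{-\varepsilon}$. If $f\in L^p(\mathbb R^n)$ is complex-valued and is a tempered distribution (that is, $f\psi$ is integrable for every Schwartz function $\psi$, and $\psi\mapsto\int f\psi$ is a tempered distribution; this is automatic if $p\ge 1$), and if its distributional Fourier transform satisfies $\operatorname{supp}\hat f\subseteq \{\xi\in\mathbb R^n:|\xi|\le1\}$, then $M^t_{\delta S_{\alpha,\beta}}f$ is measurable and $$\|M^t_{\delta S_{\alpha,\beta}}f\|_{L^p(\mathbb R^n)}\le C\left(\frac1\delta\right)^{4\left(\frac nr+1\right)\varepsilon}\|f\|_{L^p(\mathbb R^n)}.$$ -/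

import Mathlib

open MeasureTheory
open scoped ENNReal SchwartzMap FourierTransform LineDeriv

noncomputable section

/-- The Euclidean space `ℝⁿ`. -/
abbrev RSpace (n : ℕ) : Type := EuclideanSpace ℝ (Fin n)

/-- Multi-indices in `ℕⁿ`. -/
abbrev MultiIndex (n : ℕ) : Type := Fin n → ℕ

/-- The order `|α| = α₁ + ⋯ + αₙ` of a multi-index. -/
def MultiIndex.order {n : ℕ} (α : MultiIndex n) : ℕ := ∑ i, α i

/-- The iterated partial derivative `∂^β φ` of a Schwartz function: the partial derivative in the
`i`-th coordinate direction is taken `β i` times, for every `i`. -/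
def multiDeriv {n : ℕ} (β : MultiIndex n) (φ : 𝓢(RSpace n, ℂ)) : 𝓢(RSpace n, ℂ) :=
  (List.finRange n).foldr
    (fun i (g : 𝓢(RSpace n, ℂ)) =>
      (fun h : 𝓢(RSpace n, ℂ) => (∂_{EuclideanSpace.single i (1 : ℝ)} h : 𝓢(RSpace n, ℂ)))^[β i] g)
    φ

/-- `‖φ‖_{α,β} = sup_x |x^α ∂^β φ(x)|`. -/
def schwartzSup {n : ℕ} (α β : MultiIndex n) (φ : 𝓢(RSpace n, ℂ)) : ℝ≥0∞ :=
  ⨆ x : RSpace n, ‖((∏ i, x i ^ α i : ℝ) : ℂ) * multiDeriv β φ x‖ₑ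

/-- The normalized class `S_{α,β}` of Schwartz functions `φ` with `‖φ‖_{α',β'} ≤ 1` for all
multi-indices with `|α'| ≤ |α|` and `|β'| ≤ |β|`. -/
def normalizedClass {n : ℕ} (α β : MultiIndex n) : Set 𝓢(RSpace n, ℂ) :=
  {φ | ∀ α' β' : MultiIndex n, α'.order ≤ α.order → β'.order ≤ β.order →
    schwartzSup α' β' φ ≤ 1}

/-- `g_I(x) = (1/δ)^{n-1} g(x₁/δ, …, x_{n-1}/δ, xₙ)`. -/
def anisotropic {n : ℕ} (δ : ℝ) (g : RSpace n → ℂ) (x : RSpace n) : ℂ :=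
  (((1 / δ) ^ (n - 1) : ℝ) : ℂ) *
    g (WithLp.toLp 2 fun i : Fin n => if i.val + 1 = n then x i else x i / δ)

/-- The `L¹`-normalized dilation `h_t(x) = t^{-n} h(x/t)`. -/
def dilate {n : ℕ} (t : ℝ) (h : RSpace n → ℂ) (x : RSpace n) : ℂ :=
  ((1 / t ^ n : ℝ) : ℂ) * h (t⁻¹ • x)

/-- The fixed-scale rotated anisotropic maximal function: the supremum, over the orthogonal
matrices `A` and over `Υ ∈ S_{α,β}`, of `|∫ f(x - y) Υ_{I_t}(A⁻¹ y) dy|`. -/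
def fixedScaleMaximal {n : ℕ} (δ t : ℝ) (α β : MultiIndex n) (f : RSpace n → ℂ)
    (x : RSpace n) : ℝ≥0∞ :=
  ⨆ (A : Matrix.orthogonalGroup (Fin n) ℝ) (Υ ∈ normalizedClass α β),
    ‖∫ y : RSpace n, f (x - y) * dilate t (anisotropic δ (fun z => Υ z))
      (Matrix.toEuclideanLin ((A⁻¹ : Matrix.orthogonalGroup (Fin n) ℝ) :
        Matrix (Fin n) (Fin n) ℝ) y)‖ₑ

/-- The tempered distribution `u` is given by integration against the function `f`. -/
def Represents {n : ℕ} (u : 𝓢'(RSpace n, ℂ)) (f : RSpace n → ℂ) : Prop :=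
  ∀ ψ : 𝓢(RSpace n, ℂ),
    Integrable (fun x => f x * ψ x) volume ∧ u ψ = ∫ x, f x * ψ x

/-- `supp f̂ ⊆ K`: the function `f` is a tempered distribution (automatic for `f ∈ L^p`, `1 ≤ p`,
but not for `p < 1`), and the support of its distributional Fourier transform is contained
in `K`. -/
def HasFourierSupportIn {n : ℕ} (f : RSpace n → ℂ) (K : Set (RSpace n)) : Prop :=
  ∃ u : 𝓢'(RSpace n, ℂ), Represents u f ∧
    Distribution.dsupport (𝓕 u : 𝓢'(RSpace n, ℂ)) ⊆ K

end

/-! Since `f` has spectrum in the unit ball, it agrees almost everywhere with a continuous `g` that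
reproduces itself under convolution with a fixed Schwartz function `η`
(`ae_eq_integral_mul_reproducingKernel`). Everything reduces to the Peetre maximal function of `g`,
the supremum over `z` of `|g z| (1 + |x - z|)^(-b)`.

Pointwise, the rotated anisotropic averages are at most a constant times `(1 + t)^b` times this
function (`fixedScaleMaximal_le`). A rescaled kernel is the Jacobian times `Υ ∘ Λ`, and `|y| ≤ t |Λ
y|` because squeezing by `δ < 1` only shrinks supports. A change of variables therefore costs `(1 +
t)^b` and no power of `1/δ`.

In `L^p`, reproduction by `η` bounds the `p`-th power of the Peetre function by the convolution of
`|g|^p` with `(1 + |·|)^(-bp)`, also for `p < 1` (`exists_peetreMaximal_rpow_le`). This weight is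
integrable once `bp > n`, so Tonelli gives the `L^p` bound. With `b = 2n/p` and `t ≤ δ^(-ε)`, the
loss `(1 + t)^b` fits under the stated power of `1/δ`.

For `p < 1` a priori finiteness must be earned: integrability against every Schwartz function forces
polynomial growth in the mean (`exists_lintegral_mul_polyWeight_lt_top`), hence pointwise polynomial
growth of `g`. -/

noncomputable section

/-! ### Polynomial weights and the Peetre maximal function. -/

section Weights

variable {E : Type*} [NormedAddCommGroup E]

/-- The polynomial weight `(1 + ‖x‖)^(-b)`. -/
def polyWeight (b : ℝ) (x : E) : ℝ≥0∞ := ENNReal.ofReal ((1 + ‖x‖) ^ (-b))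

theorem one_add_norm_pos (x : E) : 0 < 1 + ‖x‖ := by positivity

theorem polyWeight_ne_top (b : ℝ) (x : E) : polyWeight b x ≠ ∞ := ENNReal.ofReal_ne_top

theorem polyWeight_ne_zero (b : ℝ) (x : E) : polyWeight b x ≠ 0 := by
  have := Real.rpow_pos_of_pos (one_add_norm_pos x) (-b)
  simpa [polyWeight] using this

theorem polyWeight_neg (b : ℝ) (x : E) : polyWeight b (-x) = polyWeight b x := by
  simp [polyWeight]

theorem polyWeight_zero_right (b : ℝ) : polyWeight b (0 : E) = 1 := by
  simp [polyWeight]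

/-- Follows from `1 + |x + y| ≤ (1 + |x|)(1 + |y|)`; this is what lets weights be recentred
throughout. -/
theorem polyWeight_mul_le {b : ℝ} (hb : 0 ≤ b) (x y : E) :
    polyWeight b x * polyWeight b y ≤ polyWeight b (x + y) := by
  unfold polyWeight
  rw [← ENNReal.ofReal_mul (by positivity), ← Real.mul_rpow (by positivity) (by positivity)]
  apply ENNReal.ofReal_le_ofReal
  apply Real.rpow_le_rpow_of_nonpos (by positivity) _ (by linarith)
  nlinarith [norm_add_le x y, norm_nonneg x, norm_nonneg y, mul_nonneg (norm_nonneg x) (norm_nonneg y)]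

theorem polyWeight_rpow (b : ℝ) {p : ℝ} (hp : 0 ≤ p) (x : E) :
    polyWeight b x ^ p = polyWeight (b * p) x := by
  unfold polyWeight
  rw [ENNReal.ofReal_rpow_of_nonneg (by positivity) hp, ← Real.rpow_mul (by positivity)]
  ring_nf

theorem polyWeight_add (b c : ℝ) (x : E) :
    polyWeight (b + c) x = polyWeight b x * polyWeight c x := by
  unfold polyWeight
  rw [← ENNReal.ofReal_mul (by positivity), ← Real.rpow_add (by positivity)]
  ring_nf

theorem polyWeight_anti {b c : ℝ} (h : b ≤ c) (x : E) : polyWeight c x ≤ polyWeight b x :=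
  ENNReal.ofReal_le_ofReal
    (Real.rpow_le_rpow_of_exponent_le (by linarith [norm_nonneg x]) (by linarith))

theorem polyWeight_le_one {b : ℝ} (hb : 0 ≤ b) (x : E) : polyWeight b x ≤ 1 := by
  simpa [polyWeight] using polyWeight_anti hb x

theorem polyWeight_inv (b : ℝ) (x : E) : (polyWeight b x)⁻¹ = polyWeight (-b) x := by
  unfold polyWeight
  rw [← ENNReal.ofReal_inv_of_pos (by positivity), ← Real.rpow_neg (by positivity)]

theorem continuous_polyWeight (b : ℝ) : Continuous (polyWeight b : E → ℝ≥0∞) := by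
  unfold polyWeight
  refine ENNReal.continuous_ofReal.comp (Continuous.rpow_const (by fun_prop) fun x => Or.inl ?_)
  positivity

theorem lintegral_polyWeight_lt_top [NormedSpace ℝ E] [FiniteDimensional ℝ E] [MeasurableSpace E]
    [BorelSpace E] (μ : Measure E) [μ.IsAddHaarMeasure] {b : ℝ}
    (hb : (Module.finrank ℝ E : ℝ) < b) : ∫⁻ x, polyWeight b x ∂μ < ∞ := by
  have h := (integrable_one_add_norm (μ := μ) hb).hasFiniteIntegral
  refine lt_of_eq_of_lt (lintegral_congr fun x => ?_) h
  rw [Real.enorm_eq_ofReal (by positivity)]; rfl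

/-- The Peetre maximal function `sup_z |g z| (1 + |x - z|)^(-b)`. -/
def peetreMaximal (b : ℝ) (g : E → ℂ) (x : E) : ℝ≥0∞ := ⨆ z, ‖g z‖ₑ * polyWeight b (x - z)

theorem le_peetreMaximal (b : ℝ) (g : E → ℂ) (x z : E) :
    ‖g z‖ₑ * polyWeight b (x - z) ≤ peetreMaximal b g x :=
  le_iSup (fun z => ‖g z‖ₑ * polyWeight b (x - z)) z

theorem enorm_le_peetreMaximal (b : ℝ) (g : E → ℂ) (x : E) : ‖g x‖ₑ ≤ peetreMaximal b g x := by
  simpa [polyWeight_zero_right] using le_peetreMaximal b g x x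

/-- Writing `x - z = (x - w) + (w - z)` moves the weight from `w` to `z`, so the right side no
longer depends on `w` through the weight and a supremum over `w` can be taken. -/
theorem enorm_mul_polyWeight_le_lintegral [MeasurableSpace E] {μ : Measure E} {b : ℝ} (hb : 0 ≤ b) {g : E → ℂ} (v : E → ℝ≥0∞) (x w : E)
    (hg : ‖g w‖ₑ ≤ ∫⁻ z, ‖g z‖ₑ * (polyWeight b (w - z) * v z) ∂μ) :
    ‖g w‖ₑ * polyWeight b (x - w) ≤ ∫⁻ z, ‖g z‖ₑ * polyWeight b (x - z) * v z ∂μ := by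
  refine (mul_le_mul_left hg _).trans ?_
  rw [← lintegral_mul_const' _ _ (polyWeight_ne_top _ _)]
  refine lintegral_mono fun z => ?_
  have := polyWeight_mul_le hb (x - w) (w - z)
  rw [sub_add_sub_cancel] at this
  calc _ = ‖g z‖ₑ * (polyWeight b (x - w) * polyWeight b (w - z)) * v z := by ring
    _ ≤ _ := by gcongr

end Weights

/-! ### The Peetre inequality and its integrated form. -/

section Peetre

variable {E : Type*} [NormedAddCommGroup E] [MeasurableSpace E] [BorelSpace E] {μ : Measure E}

/-- The Peetre inequality for `p ≤ 1`, assuming finiteness of the maximal function. -/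
theorem peetreMaximal_rpow_le_of_le_one {p : ℝ} (hp : 0 < p) (hp1 : p ≤ 1) {b : ℝ} (hb : 0 ≤ b)
    {C : ℝ≥0∞} {g : E → ℂ} (hgm : Measurable g)
    (hg : ∀ w, ‖g w‖ₑ ≤ C * ∫⁻ z, ‖g z‖ₑ * polyWeight b (w - z) ∂μ) (x : E)
    (hfin : peetreMaximal b g x ≠ ∞) :
    peetreMaximal b g x ^ p ≤ C * ∫⁻ z, ‖g z‖ₑ ^ p * polyWeight (b * p) (x - z) ∂μ := by
  set G := peetreMaximal b g x with hG
  rcases eq_or_ne G 0 with h0 | h0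
  · simp [h0, hp]
  -- Split each factor as `a = a ^ (1 - p) * a ^ p` and bound the first part by the supremum `G`. As
  -- `0 < G < ∞`, the power `G ^ (1 - p)` can then be cancelled.
  have key : G ≤ G ^ (1 - p) * (C * ∫⁻ z, ‖g z‖ₑ ^ p * polyWeight (b * p) (x - z) ∂μ) := by
    refine iSup_le fun w => ?_
    have hmeas : Measurable fun z => ‖g z‖ₑ * polyWeight b (w - z) :=
      hgm.enorm.mul ((continuous_polyWeight b).measurable.comp (by fun_prop))
    have h1 := enorm_mul_polyWeight_le_lintegral (μ := μ) hb (fun _ => C) x w (by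
      refine (hg w).trans_eq ?_
      rw [← lintegral_const_mul _ hmeas]
      exact lintegral_congr fun z => by ring)
    refine h1.trans ?_
    have hmeas2 : Measurable fun z => ‖g z‖ₑ ^ p * polyWeight (b * p) (x - z) :=
      (hgm.enorm.pow_const p).mul ((continuous_polyWeight _).measurable.comp (by fun_prop))
    rw [← lintegral_const_mul _ hmeas2, ← lintegral_const_mul _ (hmeas2.const_mul C)]
    refine lintegral_mono fun z => ?_
    have h2 : ‖g z‖ₑ * polyWeight b (x - z) ≤
        G ^ (1 - p) * (‖g z‖ₑ * polyWeight b (x - z)) ^ p := by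
      have hle := le_peetreMaximal b g x z
      set a := ‖g z‖ₑ * polyWeight b (x - z)
      calc a = a ^ ((1 - p) + p) := by simp
        _ = a ^ (1 - p) * a ^ p := ENNReal.rpow_add_of_nonneg _ _ (by linarith) hp.le
        _ ≤ _ := by gcongr
    rw [ENNReal.mul_rpow_of_nonneg _ _ hp.le, polyWeight_rpow _ hp.le] at h2
    calc _ ≤ (G ^ (1 - p) * (‖g z‖ₑ ^ p * polyWeight (b * p) (x - z))) * C := by gcongr
      _ = _ := by ring
  have h3 : G ^ (1 - p) ≠ 0 := by simp [ENNReal.rpow_eq_zero_iff, h0, hfin]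
  have h4 : G ^ (1 - p) ≠ ∞ := ENNReal.rpow_ne_top_of_nonneg (by linarith) hfin
  have h5 : G ^ (1 - p) * G ^ p = G := by
    rw [← ENNReal.rpow_add_of_nonneg _ _ (by linarith) hp.le]; simp
  rw [← h5] at key
  nth_rw 2 [h5] at key
  exact (ENNReal.mul_le_mul_iff_right h3 h4).1 key

variable [NormedSpace ℝ E] [FiniteDimensional ℝ E] [μ.IsAddHaarMeasure]

/-- The Peetre inequality for `p > 1`. -/
theorem peetreMaximal_rpow_le_of_one_lt {p : ℝ} (hp : 1 < p) {b s : ℝ} (hb : 0 ≤ b) (hs : 0 ≤ s)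
    {C : ℝ≥0∞} (hC : C ≠ ∞) {g : E → ℂ} (hgm : Measurable g)
    (hg : ∀ w, ‖g w‖ₑ ≤ C * ∫⁻ z, ‖g z‖ₑ * polyWeight (b + s) (w - z) ∂μ) (x : E) :
    peetreMaximal b g x ^ p ≤ (C * (∫⁻ z, polyWeight s z ∂μ) ^ (1 - 1 / p)) ^ p *
      ∫⁻ z, ‖g z‖ₑ ^ p * polyWeight (b * p) (x - z) ∂μ := by
  have hp0 : 0 < p := by linarith
  obtain ⟨q, hq⟩ : ∃ q, p.HolderConjugate q := ⟨_, Real.HolderConjugate.conjExponent hp⟩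
  have hq1 : 1 / q = 1 - 1 / p := by
    have := hq.inv_add_inv_eq_one; simp only [one_div]; linarith
  have key : peetreMaximal b g x ≤ (C * (∫⁻ z, polyWeight s z ∂μ) ^ (1 - 1 / p)) *
      (∫⁻ z, ‖g z‖ₑ ^ p * polyWeight (b * p) (x - z) ∂μ) ^ (1 / p) := by
    refine iSup_le fun w => ?_
    have hmeas : ∀ b x, Measurable fun z => ‖g z‖ₑ * polyWeight b (x - z) := fun b x =>
      hgm.enorm.mul ((continuous_polyWeight b).measurable.comp (by fun_prop))
    have hm1 : Measurable fun z : E => polyWeight s (w - z) :=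
      (continuous_polyWeight s).measurable.comp (by fun_prop)
    -- Of the decay `b + s`, the part `b` recentres the weight at `x` and the part `s` is kept for
    -- the dual factor in Hölder's inequality.
    have h1 := enorm_mul_polyWeight_le_lintegral (μ := μ) hb (fun z => C * polyWeight s (w - z))
      x w (by
        refine (hg w).trans_eq ?_
        rw [← lintegral_const_mul _ (hmeas _ _)]
        exact lintegral_congr fun z => by rw [polyWeight_add]; ring)
    refine h1.trans ?_
    have h2 := ENNReal.lintegral_mul_le_Lp_mul_Lq μ hq (hmeas b x).aemeasurable hm1.aemeasurable
    have h3 : ∫⁻ z, polyWeight s (w - z) ^ q ∂μ ≤ ∫⁻ z, polyWeight s z ∂μ := by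
      rw [← lintegral_sub_left_eq_self (fun z => polyWeight s z) w]
      refine lintegral_mono fun z => ?_
      rw [polyWeight_rpow _ hq.symm.nonneg]
      exact polyWeight_anti (by nlinarith [hq.symm.lt]) _
    calc _ = C * ∫⁻ z, (‖g z‖ₑ * polyWeight b (x - z)) * polyWeight s (w - z) ∂μ := by
            rw [← lintegral_const_mul' _ _ hC]
            exact lintegral_congr fun z => by ring
      _ ≤ C * ((∫⁻ z, (‖g z‖ₑ * polyWeight b (x - z)) ^ p ∂μ) ^ (1 / p) *
            (∫⁻ z, polyWeight s (w - z) ^ q ∂μ) ^ (1 / q)) := by gcongr; exact h2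
      _ ≤ C * ((∫⁻ z, (‖g z‖ₑ * polyWeight b (x - z)) ^ p ∂μ) ^ (1 / p) *
            (∫⁻ z, polyWeight s z ∂μ) ^ (1 / q)) := by
            gcongr; exact one_div_nonneg.2 hq.symm.nonneg
      _ = _ := by
        rw [hq1]
        simp_rw [ENNReal.mul_rpow_of_nonneg _ _ hp0.le, polyWeight_rpow _ hp0.le]
        ring
  calc _ ≤ _ := ENNReal.rpow_le_rpow key hp0.le
    _ = _ := by
      rw [ENNReal.mul_rpow_of_nonneg _ _ hp0.le, ← ENNReal.rpow_mul, one_div_mul_cancel hp0.ne',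
        ENNReal.rpow_one]

/-- The Peetre inequality for functions that reproduce themselves by convolution with a rapidly
decreasing function, with a constant that does not depend on the function. -/
theorem exists_peetreMaximal_rpow_le {p : ℝ} (hp : 0 < p) {b : ℝ} (hb : 0 ≤ b) {η : E → ℂ}
    (hη : ∀ c : ℝ, ∃ C : ℝ≥0∞, C ≠ ∞ ∧ ∀ x, ‖η x‖ₑ ≤ C * polyWeight c x) :
    ∃ C : ℝ≥0∞, C ≠ ∞ ∧ ∀ g : E → ℂ, Measurable g →
      (∀ w, ‖g w‖ₑ ≤ ∫⁻ z, ‖g z‖ₑ * ‖η (w - z)‖ₑ ∂μ) →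
      (∃ N : ℝ, ∃ D : ℝ≥0∞, D ≠ ∞ ∧ ∀ x, ‖g x‖ₑ * polyWeight N x ≤ D) →
      ∫⁻ z, ‖g z‖ₑ ^ p ∂μ ≠ ∞ →
      ∀ x, peetreMaximal b g x ^ p ≤
        C * ∫⁻ z, ‖g z‖ₑ ^ p * polyWeight (b * p) (x - z) ∂μ := by
  have repr : ∀ {c : ℝ} {C : ℝ≥0∞}, (∀ x, ‖η x‖ₑ ≤ C * polyWeight c x) → ∀ g : E → ℂ,
      Measurable g → (∀ w, ‖g w‖ₑ ≤ ∫⁻ z, ‖g z‖ₑ * ‖η (w - z)‖ₑ ∂μ) →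
      ∀ w, ‖g w‖ₑ ≤ C * ∫⁻ z, ‖g z‖ₑ * polyWeight c (w - z) ∂μ := by
    intro c C h g hgm hg w
    refine (hg w).trans ?_
    have hm : Measurable fun z => ‖g z‖ₑ * polyWeight c (w - z) :=
      hgm.enorm.mul ((continuous_polyWeight c).measurable.comp (by fun_prop))
    rw [← lintegral_const_mul _ hm]
    refine lintegral_mono fun z => ?_
    calc _ ≤ ‖g z‖ₑ * (C * polyWeight c (w - z)) := by gcongr; exact h _
      _ = _ := by ring
  rcases le_or_gt p 1 with hp1 | hp1
  · obtain ⟨C, hC, hηC⟩ := hη b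
    refine ⟨C, hC, fun g hgm hg hgrow hfin => ?_⟩
    -- Any Peetre inequality, whatever its exponent and constant, makes `g` bounded, since the
    -- weight is at most `1`.
    have bdd : ∀ {b' : ℝ} {C : ℝ≥0∞}, 0 ≤ b' → C ≠ ∞ →
        (∀ x, peetreMaximal b' g x ^ p ≤
          C * ∫⁻ z, ‖g z‖ₑ ^ p * polyWeight (b' * p) (x - z) ∂μ) →
        ∃ D : ℝ≥0∞, D ≠ ∞ ∧ ∀ x, ‖g x‖ₑ ≤ D := by
      intro b' C hb' hC h
      refine ⟨(C * ∫⁻ z, ‖g z‖ₑ ^ p ∂μ) ^ (1 / p),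
        ENNReal.rpow_ne_top_of_nonneg (by positivity) (ENNReal.mul_ne_top hC hfin), fun x => ?_⟩
      have h1 : ‖g x‖ₑ ^ p ≤ C * ∫⁻ z, ‖g z‖ₑ ^ p ∂μ := by
        refine (ENNReal.rpow_le_rpow (enorm_le_peetreMaximal b' g x) hp.le).trans ((h x).trans ?_)
        gcongr with z
        exact mul_le_of_le_one_right' (polyWeight_le_one (by positivity) _)
      calc ‖g x‖ₑ = (‖g x‖ₑ ^ p) ^ (1 / p) := by
            rw [← ENNReal.rpow_mul, mul_one_div_cancel hp.ne', ENNReal.rpow_one]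
        _ ≤ _ := ENNReal.rpow_le_rpow h1 (by positivity)
    -- Bootstrap: with an exponent at least the growth order `N`, the maximal function is finite.
    -- The constant `C'` depends on `g` through `N`, but only boundedness is extracted; that makes
    -- the maximal function of order `b` finite, and the uniform constant `C` applies.
    have hbound : ∃ D : ℝ≥0∞, D ≠ ∞ ∧ ∀ x, ‖g x‖ₑ ≤ D := by
      obtain ⟨N, D, hD, hN⟩ := hgrow
      obtain ⟨C', hC', hηC'⟩ := hη (max N 0)
      refine bdd (le_max_right N 0) hC' fun x => ?_
      refine peetreMaximal_rpow_le_of_le_one hp hp1 (le_max_right _ _) hgm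
        (repr hηC' g hgm hg) x ?_
      have h1 : peetreMaximal (max N 0) g x * polyWeight (max N 0) x ≤ D := by
        unfold peetreMaximal
        rw [ENNReal.iSup_mul]
        refine iSup_le fun z => le_trans ?_ (hN z)
        have h2 := polyWeight_mul_le (le_max_right N 0) (x - z) (-x)
        rw [polyWeight_neg, show x - z + -x = -z by abel, polyWeight_neg] at h2
        rw [mul_assoc]
        gcongr
        exact h2.trans (polyWeight_anti (le_max_left _ _) _)
      intro htop
      rw [htop, ENNReal.top_mul (polyWeight_ne_zero _ _), top_le_iff] at h1
      exact hD h1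
    refine fun x => peetreMaximal_rpow_le_of_le_one hp hp1 hb hgm (repr hηC g hgm hg) x ?_
    obtain ⟨D, hD, hgD⟩ := hbound
    refine ne_top_of_le_ne_top hD (iSup_le fun z => ?_)
    exact (mul_le_of_le_one_right' (polyWeight_le_one hb _)).trans (hgD z)
  · set s : ℝ := Module.finrank ℝ E + 1 with hs
    obtain ⟨C, hC, hηC⟩ := hη (b + s)
    have hCt : (C * (∫⁻ z : E, polyWeight s z ∂μ) ^ (1 - 1 / p)) ^ p ≠ ∞ := by
      refine ENNReal.rpow_ne_top_of_nonneg hp.le (ENNReal.mul_ne_top hC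
        (ENNReal.rpow_ne_top_of_nonneg ?_ (lintegral_polyWeight_lt_top μ (by simp [hs])).ne))
      rw [sub_nonneg, div_le_one hp]; exact hp1.le
    refine ⟨_, hCt, fun g hgm hg _ _ x => peetreMaximal_rpow_le_of_one_lt hp1 hb (by positivity : 0 ≤ s) hC
      hgm (repr hηC g hgm hg) x⟩

/-- Tonelli and translation invariance, as for Young's inequality with an `L^1` kernel. -/
theorem lintegral_peetreMaximal_rpow_le {p : ℝ} {b : ℝ} {C : ℝ≥0∞} {g : E → ℂ} (hgm : Measurable g)
    (h : ∀ x, peetreMaximal b g x ^ p ≤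
        C * ∫⁻ z, ‖g z‖ₑ ^ p * polyWeight (b * p) (x - z) ∂μ) :
    ∫⁻ x, peetreMaximal b g x ^ p ∂μ ≤
      C * (∫⁻ x, polyWeight (b * p) x ∂μ) * ∫⁻ z, ‖g z‖ₑ ^ p ∂μ := by
  have hm : Measurable fun q : E × E => ‖g q.2‖ₑ ^ p * polyWeight (b * p) (q.1 - q.2) :=
    ((hgm.comp measurable_snd).enorm.pow_const p).mul
      ((continuous_polyWeight _).measurable.comp (by fun_prop))
  calc _ ≤ ∫⁻ x, C * ∫⁻ z, ‖g z‖ₑ ^ p * polyWeight (b * p) (x - z) ∂μ ∂μ := lintegral_mono h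
    _ = C * ∫⁻ x, ∫⁻ z, ‖g z‖ₑ ^ p * polyWeight (b * p) (x - z) ∂μ ∂μ :=
      lintegral_const_mul _ hm.lintegral_prod_right'
    _ = C * ∫⁻ z, ∫⁻ x, ‖g z‖ₑ ^ p * polyWeight (b * p) (x - z) ∂μ ∂μ := by
      rw [lintegral_lintegral_swap hm.aemeasurable]
    _ = C * ∫⁻ z, (∫⁻ x, polyWeight (b * p) x ∂μ) * ‖g z‖ₑ ^ p ∂μ := by
      congr 1
      refine lintegral_congr fun z => ?_
      have hm' : Measurable fun x => polyWeight (b * p) (x - z) :=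
        (continuous_polyWeight _).measurable.comp (by fun_prop)
      rw [lintegral_const_mul _ hm', lintegral_sub_right_eq_self (fun x => polyWeight (b * p) x) z, mul_comm]
    _ = _ := by rw [lintegral_const_mul _ (hgm.enorm.pow_const p), mul_assoc]

end Peetre

/-! ### Smooth cutoffs and supports of tempered distributions. -/

section Cutoff

open scoped ContDiff Topology
open Filter Distribution

/-- The sum of a series of Schwartz functions that is summable in every seminorm. -/
theorem exists_schwartzMap_eq_tsum {E : Type*} [NormedAddCommGroup E] [NormedSpace ℝ E]
    (ψ : ℕ → E → ℂ) (hψ : ∀ m, ContDiff ℝ ∞ (ψ m))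
    (v : ℕ → ℕ → ℕ → ℝ) (hv : ∀ k l, Summable (v k l))
    (hb : ∀ k l m x, ‖x‖ ^ k * ‖iteratedFDeriv ℝ l (ψ m) x‖ ≤ v k l m) :
    ∃ Ψ : 𝓢(E, ℂ), ∀ x, Ψ x = ∑' m, ψ m x := by
  have hb0 : ∀ (l m : ℕ) (x : E), ((l : ℕ∞) ≤ (⊤ : ℕ∞)) →
      ‖iteratedFDeriv ℝ l (ψ m) x‖ ≤ v 0 l m := fun l m x _ => by simpa using hb 0 l m x
  have hsum : ∀ k l x, Summable fun m => ‖x‖ ^ k * ‖iteratedFDeriv ℝ l (ψ m) x‖ := fun k l x =>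
    (hv k l).of_nonneg_of_le (fun m => by positivity) fun m => hb k l m x
  refine ⟨⟨fun x => ∑' m, ψ m x, ?_, fun k l => ⟨∑' m, v k l m, fun x => ?_⟩⟩, fun x => rfl⟩
  · exact contDiff_tsum hψ (fun l _ => hv 0 l) hb0
  · rw [iteratedFDeriv_tsum hψ (fun l _ => hv 0 l) hb0 (by exact_mod_cast le_top)]
    have hs0 : Summable fun m => ‖iteratedFDeriv ℝ l (ψ m) x‖ := by simpa using hsum 0 l x
    calc _ ≤ ‖x‖ ^ k * ∑' m, ‖iteratedFDeriv ℝ l (ψ m) x‖ := by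
            gcongr; exact norm_tsum_le_tsum_norm hs0
      _ = ∑' m, ‖x‖ ^ k * ‖iteratedFDeriv ℝ l (ψ m) x‖ := tsum_mul_left.symm
      _ ≤ _ := (hsum k l x).tsum_le_tsum (fun m => hb k l m x) (hv k l)

variable {E : Type*} [NormedAddCommGroup E] [InnerProductSpace ℝ E] [FiniteDimensional ℝ E]

variable (E) in
/-- A smooth bump equal to `1` on the ball of radius `2` and to `0` off the ball of radius `3`. -/
def stdBump : ContDiffBump (0 : E) := ⟨2, 3, by norm_num, by norm_num⟩

/-- The complex-valued smooth cutoff at scale `R`. -/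
def cutoff (R : ℝ) (x : E) : ℂ := ((stdBump E (R⁻¹ • x) : ℝ) : ℂ)

theorem contDiff_cutoff (R : ℝ) : ContDiff ℝ ∞ (cutoff R : E → ℂ) :=
  Complex.ofRealCLM.contDiff.comp ((stdBump E).contDiff.comp (contDiff_const_smul _))

theorem cutoff_eq_one {R : ℝ} (hR : 0 < R) {x : E} (hx : ‖x‖ ≤ 2 * R) : cutoff R x = 1 := by
  unfold cutoff
  rw [(stdBump E).one_of_mem_closedBall]
  · simp
  · rw [mem_closedBall_zero_iff, norm_smul, norm_inv, Real.norm_of_nonneg hR.le,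
      inv_mul_le_iff₀ hR]
    simpa [stdBump, mul_comm] using hx

theorem cutoff_eq_zero {R : ℝ} (hR : 0 < R) {x : E} (hx : 3 * R ≤ ‖x‖) : cutoff R x = 0 := by
  unfold cutoff
  rw [(stdBump E).zero_of_le_dist]
  · simp
  · rw [dist_zero_right, norm_smul, norm_inv, Real.norm_of_nonneg hR.le, le_inv_mul_iff₀ hR]
    simpa [stdBump, mul_comm] using hx

theorem tsupport_cutoff_subset {R : ℝ} (hR : 0 < R) :
    tsupport (cutoff R : E → ℂ) ⊆ Metric.closedBall 0 (3 * R) := by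
  refine closure_minimal (fun x hx => ?_) Metric.isClosed_closedBall
  rw [mem_closedBall_zero_iff]
  by_contra h
  exact hx (cutoff_eq_zero hR (by linarith))

theorem hasCompactSupport_cutoff {R : ℝ} (hR : 0 < R) :
    HasCompactSupport (cutoff R : E → ℂ) :=
  (isCompact_closedBall _ _).of_isClosed_subset (isClosed_tsupport _) (tsupport_cutoff_subset hR)

theorem hasTemperateGrowth_cutoff {R : ℝ} (hR : 0 < R) :
    (cutoff R : E → ℂ).HasTemperateGrowth :=
  (hasCompactSupport_cutoff hR).hasTemperateGrowth (contDiff_cutoff R)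

-- Each derivative of the rescaled bump brings a factor `R⁻¹ ≤ 1`, so the bound at scale `1` serves
-- all scales.
variable (E) in
theorem exists_norm_iteratedFDeriv_cutoff_le (l : ℕ) :
    ∃ C : ℝ, 0 ≤ C ∧ ∀ R : ℝ, 1 ≤ R → ∀ x : E, ‖iteratedFDeriv ℝ l (cutoff R) x‖ ≤ C := by
  obtain ⟨C, hC⟩ := ((hasCompactSupport_cutoff (E := E) one_pos).toSchwartzMap
    (contDiff_cutoff 1)).decay 0 l
  refine ⟨C, hC.1.le, fun R hR x => ?_⟩
  have hR0 : 0 < R := by linarith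
  have h := hC.2 (R⁻¹ • x)
  have heq : (cutoff R : E → ℂ) = fun z => cutoff 1 (R⁻¹ • z) := by
    ext z; simp [cutoff]
  rw [heq, iteratedFDeriv_comp_const_smul _
    ((contDiff_cutoff 1).of_le (by exact_mod_cast le_top)), norm_smul]
  have h1 : ‖R⁻¹ ^ l‖ ≤ 1 := by
    rw [norm_pow, norm_inv, Real.norm_of_nonneg hR0.le]
    exact pow_le_one₀ (by positivity) (inv_le_one_of_one_le₀ hR)
  simp only [pow_zero, one_mul] at h
  calc _ ≤ 1 * C := by gcongr; exact h
    _ = C := one_mul C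

variable (E) in
/-- The cutoff at scale `R` has Schwartz seminorms growing at most polynomially in `R`. -/
theorem exists_pow_mul_norm_iteratedFDeriv_cutoff_le (k l : ℕ) :
    ∃ C : ℝ, 0 ≤ C ∧ ∀ R : ℝ, 1 ≤ R → ∀ x : E,
      ‖x‖ ^ k * ‖iteratedFDeriv ℝ l (cutoff R) x‖ ≤ C * R ^ k := by
  obtain ⟨C, hC0, hC⟩ := exists_norm_iteratedFDeriv_cutoff_le E l
  refine ⟨3 ^ k * C, by positivity, fun R hR x => ?_⟩
  have hR0 : 0 < R := by linarith
  by_cases hx : iteratedFDeriv ℝ l (cutoff R) x = 0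
  · rw [hx]; simp; positivity
  · have h1 := mem_closedBall_zero_iff.1
      (tsupport_cutoff_subset hR0 (support_iteratedFDeriv_subset (𝕜 := ℝ) l hx))
    calc _ ≤ (3 * R) ^ k * C := by gcongr; exact hC R hR x
      _ = _ := by ring

/-- The error vanishes near every point with `|x| < R`; where `|x| ≥ R`, one more power of `|x|` in
the seminorm gains a factor `1/R`. -/
theorem tendsto_cutoff_smul (φ : 𝓢(E, ℂ)) :
    Tendsto (fun m : ℕ => SchwartzMap.smulLeftCLM ℂ (cutoff ((m : ℝ) + 1)) φ) atTop (𝓝 φ) := by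
  rw [(schwartz_withSeminorms ℝ E ℂ).tendsto_nhds _ φ]
  rintro ⟨k, l⟩ ε hε
  choose C hC0 hC using exists_norm_iteratedFDeriv_cutoff_le E
  set D : ℝ := ∑ i ∈ Finset.range (l + 1), (l.choose i : ℝ) * (C i + 1) *
    SchwartzMap.seminorm ℝ (k + 1) (l - i) φ with hD
  have hD0 : 0 ≤ D := Finset.sum_nonneg fun i _ => by
    have := hC0 i
    positivity
  have key : ∀ m : ℕ, schwartzSeminormFamily ℝ E ℂ (k, l)
      (SchwartzMap.smulLeftCLM ℂ (cutoff ((m : ℝ) + 1)) φ - φ) ≤ D / ((m : ℝ) + 1) := by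
    intro m
    set R : ℝ := (m : ℝ) + 1 with hR
    have hR1 : 1 ≤ R := by simp [hR]
    have hR0 : 0 < R := by linarith
    refine SchwartzMap.seminorm_le_bound ℝ k l _ (by positivity) fun x => ?_
    set h : E → ℂ := fun x => cutoff R x - 1 with hh
    have hsm : ContDiff ℝ ∞ h := (contDiff_cutoff R).sub contDiff_const
    have heq : (⇑(SchwartzMap.smulLeftCLM ℂ (cutoff R) φ - φ) : E → ℂ) = fun x => h x • φ x := by
      ext y
      simp [hh, SchwartzMap.smulLeftCLM_apply_apply (hasTemperateGrowth_cutoff hR0), sub_mul]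
    rw [heq]
    by_cases hx : R ≤ ‖x‖
    · have hb : ∀ i, ‖iteratedFDeriv ℝ i h x‖ ≤ C i + 1 := by
        intro i
        rw [hh, fun_iteratedFDeriv_sub_apply]
        · refine (norm_sub_le _ _).trans (add_le_add (hC i R hR1 x) ?_)
          rcases Nat.eq_zero_or_pos i with rfl | hi
          · simp
          · rw [iteratedFDeriv_const_of_ne hi.ne']; simp
        · exact ((contDiff_cutoff R).of_le (by exact_mod_cast le_top)).contDiffAt
        · exact contDiffAt_const
      have hleib := norm_iteratedFDeriv_smul_le hsm (φ.smooth ⊤) x (n := l)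
        (by exact_mod_cast le_top)
      rw [le_div_iff₀ hR0]
      calc _ ≤ ‖x‖ ^ k * (∑ i ∈ Finset.range (l + 1), (l.choose i : ℝ) *
              ‖iteratedFDeriv ℝ i h x‖ * ‖iteratedFDeriv ℝ (l - i) φ x‖) * ‖x‖ := by gcongr
        _ = ∑ i ∈ Finset.range (l + 1), (l.choose i : ℝ) * ‖iteratedFDeriv ℝ i h x‖ *
              (‖x‖ ^ (k + 1) * ‖iteratedFDeriv ℝ (l - i) φ x‖) := by
            rw [Finset.mul_sum, Finset.sum_mul]
            exact Finset.sum_congr rfl fun i _ => by ring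
        _ ≤ D := by
            refine Finset.sum_le_sum fun i _ => ?_
            have := hC0 i
            gcongr
            · exact hb i
            · exact SchwartzMap.le_seminorm ℝ (k + 1) (l - i) φ x
    · have hz : (fun x => h x • φ x) =ᶠ[𝓝 x] fun _ => 0 := by
        have : Metric.ball (0 : E) R ∈ 𝓝 x :=
          Metric.isOpen_ball.mem_nhds (by simpa using hx)
        filter_upwards [this] with y hy
        rw [mem_ball_zero_iff] at hy
        simp [hh, cutoff_eq_one hR0 (x := y) (by linarith)]
      rw [(hz.iteratedFDeriv ℝ l).eq_of_nhds]
      simp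
      positivity
  have hlim : Tendsto (fun m : ℕ => D / ((m : ℝ) + 1)) atTop (𝓝 0) :=
    tendsto_const_nhds.div_atTop (tendsto_natCast_atTop_atTop.atTop_add tendsto_const_nhds)
  filter_upwards [hlim.eventually (gt_mem_nhds hε)] with m hm
  exact (key m).trans_lt hm

/-- A tempered distribution vanishes on compactly supported test functions whose support does not
meet its own. -/
theorem apply_eq_zero_of_hasCompactSupport (v : 𝓢'(E, ℂ)) (φ : 𝓢(E, ℂ))
    (hc : HasCompactSupport φ) (hd : Disjoint (tsupport φ) (dsupport v)) : v φ = 0 := by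
  have hx : ∀ x ∈ tsupport φ, ∃ s : Set E, IsVanishingOn v s ∧ IsOpen s ∧ x ∈ s := fun x hx =>
    (notMem_dsupport_iff x).1 (Set.disjoint_left.1 hd hx)
  choose! U hUv hUo hUx using hx
  obtain ⟨t, ht, htU⟩ := IsCompact.elim_nhds_subcover hc U
    fun x hx => (hUo x hx).mem_nhds (hUx x hx)
  -- Finitely many open sets on which `v` vanishes cover the support; the partition of unity splits
  -- `φ` into pieces, each supported in one of them.
  obtain ⟨f, hf⟩ := SmoothPartitionOfUnity.exists_isSubordinate (modelWithCornersSelf ℝ E)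
    (isClosed_tsupport φ) (fun i : t => U i) (fun i => hUo i (ht i i.2))
    (htU.trans (by intro x hx; simpa using hx))
  have hcs : ∀ i : t, HasCompactSupport fun x => ((f i x : ℝ) : ℂ) * φ x := fun i => hc.mul_left
  have hsm : ∀ i : t, ContDiff ℝ ∞ fun x => ((f i x : ℝ) : ℂ) * φ x := fun i =>
    (Complex.ofRealCLM.contDiff.comp (f i).contMDiff.contDiff).mul (φ.smooth ⊤)
  have hsum : φ = ∑ i : t, (hcs i).toSchwartzMap (hsm i) := by
    ext x
    rw [sum_apply]
    simp only [HasCompactSupport.toSchwartzMap_toFun]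
    change φ x = ∑ i : t, ((f i x : ℝ) : ℂ) * φ x
    by_cases hx : x ∈ tsupport φ
    · have h1 := f.sum_eq_one hx
      rw [finsum_eq_sum_of_fintype] at h1
      rw [← Finset.sum_mul, ← Complex.ofReal_sum, h1]
      simp
    · simp [image_eq_zero_of_notMem_tsupport hx]
  rw [hsum, map_sum]
  refine Finset.sum_eq_zero fun i _ => hUv i (ht i i.2) _ ?_
  refine (closure_mono fun x hx => ?_).trans (hf i)
  intro h0
  apply hx
  change ((f i x : ℝ) : ℂ) * φ x = 0
  rw [h0]; simp

/-- A tempered distribution with support in the unit ball vanishes on Schwartz functions that are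
zero on the ball of radius `2`. -/
theorem apply_eq_zero_of_eq_zero_on_ball (v : 𝓢'(E, ℂ))
    (hv : dsupport v ⊆ Metric.closedBall 0 1) (φ : 𝓢(E, ℂ)) (hφ : ∀ x, ‖x‖ < 2 → φ x = 0) :
    v φ = 0 := by
  have h0 : ∀ m : ℕ, v (SchwartzMap.smulLeftCLM ℂ (cutoff ((m : ℝ) + 1)) φ) = 0 := by
    intro m
    have hm : (0 : ℝ) < m + 1 := by positivity
    have hfun := SchwartzMap.smulLeftCLM_apply (hasTemperateGrowth_cutoff (E := E) hm) φ
    refine apply_eq_zero_of_hasCompactSupport v _ ?_ ?_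
    · rw [hfun]; exact (hasCompactSupport_cutoff hm).smul_right
    · refine Disjoint.mono_right hv (Set.disjoint_left.2 fun x hx h1 => ?_)
      -- The gap between the radii `1` and `2` gives each point of the closed unit ball a
      -- neighbourhood on which `φ` is zero.
      have h2 : x ∉ tsupport φ := by
        rw [notMem_tsupport_iff_eventuallyEq]
        have : Metric.ball (0 : E) 2 ∈ 𝓝 x := by
          refine Metric.isOpen_ball.mem_nhds ?_
          rw [mem_ball_zero_iff]
          rw [mem_closedBall_zero_iff] at h1
          linarith
        filter_upwards [this] with y hy
        exact hφ y (mem_ball_zero_iff.1 hy)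
      exact h2 (SchwartzMap.tsupport_smulLeftCLM_subset _ _ hx).1
  have h1 : Tendsto (fun m : ℕ => v (SchwartzMap.smulLeftCLM ℂ (cutoff ((m : ℝ) + 1)) φ)) atTop
      (𝓝 (v φ)) := ((map_continuous v).tendsto φ).comp (tendsto_cutoff_smul φ)
  simp only [h0] at h1
  exact (tendsto_nhds_unique h1 tendsto_const_nhds)

end Cutoff

/-! ### Polynomial growth in the mean from integrability against Schwartz functions. -/

section TemperedGrowth

open Filter

variable {E : Type*} [NormedAddCommGroup E]

/-- One term suffices: for the least `j` with `|x| < 2^j` one has `2^j ≤ 2(1 + |x|)`. -/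
theorem polyWeight_le_tsum_dyadic (N : ℕ) (x : E) :
    polyWeight ((N + 1 : ℕ) : ℝ) x ≤ ∑' j : ℕ, (Metric.ball (0 : E) (2 ^ j)).indicator
      (fun _ => (2 : ℝ≥0∞) ^ (N + 1) * ((2 : ℝ≥0∞) ^ (j * (N + 1)))⁻¹) x := by
  obtain ⟨j, hj, hj'⟩ : ∃ j : ℕ, ‖x‖ < 2 ^ j ∧ (2 : ℝ) ^ j ≤ 2 * (1 + ‖x‖) := by
    have hex : ∃ j : ℕ, ‖x‖ < 2 ^ j := pow_unbounded_of_one_lt _ one_lt_two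
    classical
    refine ⟨Nat.find hex, Nat.find_spec hex, ?_⟩
    rcases Nat.eq_zero_or_pos (Nat.find hex) with h0 | h0
    · rw [h0]; linarith [norm_nonneg x, pow_zero (2 : ℝ)]
    · have := Nat.find_min hex (Nat.sub_lt h0 one_pos)
      rw [not_lt] at this
      obtain ⟨i, hi⟩ := Nat.exists_eq_succ_of_ne_zero h0.ne'
      rw [hi] at this ⊢
      simp only [Nat.succ_eq_add_one, Nat.add_sub_cancel] at this ⊢
      rw [pow_succ]; linarith
  refine le_trans ?_ (ENNReal.le_tsum j)
  rw [Set.indicator_of_mem (mem_ball_zero_iff.2 hj), ← div_eq_mul_inv,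
    ENNReal.le_div_iff_mul_le (Or.inl (by positivity)) (Or.inl (by finiteness)), pow_mul,
    show ((2 : ℝ≥0∞) ^ j) ^ (N + 1) = ENNReal.ofReal (((2 : ℝ) ^ j) ^ (N + 1)) by
      simp [ENNReal.ofReal_pow], show (2 : ℝ≥0∞) ^ (N + 1) = ENNReal.ofReal (2 ^ (N + 1)) by
      simp [ENNReal.ofReal_pow], polyWeight, ← ENNReal.ofReal_mul (by positivity)]
  refine ENNReal.ofReal_le_ofReal ?_
  rw [Real.rpow_neg (by positivity), Real.rpow_natCast, inv_mul_le_iff₀ (by positivity),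
    ← mul_pow, mul_comm]
  gcongr

/-- The extra unit in the exponent `N + 1` beats the growth `2^(jN)` and leaves a geometric series
in `2^(-j)`. -/
theorem lintegral_mul_polyWeight_lt_top_of_dyadic [MeasurableSpace E] [BorelSpace E]
    {μ : Measure E} {f : E → ℂ}
    (hf : AEStronglyMeasurable f μ) {N : ℕ} {C : ℝ≥0∞} (hC : C ≠ ∞)
    (h : ∀ j : ℕ, ∫⁻ x in Metric.ball (0 : E) (2 ^ j), ‖f x‖ₑ ∂μ ≤ C * 2 ^ (j * N)) :
    ∫⁻ x, ‖f x‖ₑ * polyWeight ((N + 1 : ℕ) : ℝ) x ∂μ < ∞ := by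
  set c : ℕ → ℝ≥0∞ := fun j => (2 : ℝ≥0∞) ^ (N + 1) * ((2 : ℝ≥0∞) ^ (j * (N + 1)))⁻¹ with hc
  have hct : ∀ j, c j ≠ ∞ := fun j => ENNReal.mul_ne_top (by finiteness) (by simp)
  calc _ ≤ ∫⁻ x, ∑' j : ℕ, (Metric.ball (0 : E) (2 ^ j)).indicator
        (fun x => c j * ‖f x‖ₑ) x ∂μ := by
        refine lintegral_mono fun x => ?_
        refine (mul_le_mul_right (polyWeight_le_tsum_dyadic N x) _).trans_eq ?_
        rw [← ENNReal.tsum_mul_left]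
        refine tsum_congr fun j => ?_
        by_cases hx : x ∈ Metric.ball (0 : E) (2 ^ j)
        · rw [Set.indicator_of_mem hx, Set.indicator_of_mem hx, mul_comm]
        · rw [Set.indicator_of_notMem hx, Set.indicator_of_notMem hx, mul_zero]
    _ = ∑' j : ℕ, c j * ∫⁻ x in Metric.ball (0 : E) (2 ^ j), ‖f x‖ₑ ∂μ := by
        rw [lintegral_tsum fun j => (hf.enorm.const_mul _).indicator Metric.isOpen_ball.measurableSet]
        refine tsum_congr fun j => ?_
        rw [lintegral_indicator Metric.isOpen_ball.measurableSet, lintegral_const_mul' _ _ (hct j)]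
    _ ≤ ∑' j : ℕ, (2 ^ (N + 1) * C) * (2⁻¹ : ℝ≥0∞) ^ j := by
        refine ENNReal.tsum_le_tsum fun j => ?_
        refine (mul_le_mul_right (h j) _).trans_eq ?_
        have : ((2 : ℝ≥0∞) ^ (j * (N + 1)))⁻¹ * 2 ^ (j * N) = (2⁻¹) ^ j := by
          rw [mul_add, mul_one, pow_add, ENNReal.mul_inv (by simp) (by simp), mul_right_comm,
            ENNReal.inv_mul_cancel (by simp) (by finiteness), one_mul, ENNReal.inv_pow]
        rw [← this]; ring
    _ < ∞ := by
        rw [ENNReal.tsum_mul_left, ENNReal.tsum_geometric]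
        simp only [ENNReal.one_sub_inv_two, inv_inv]
        exact ENNReal.mul_lt_top (ENNReal.mul_lt_top (by finiteness) hC.lt_top) (by simp)

end TemperedGrowth

section TemperedGrowth

open Filter

variable {E : Type*} [NormedAddCommGroup E] [InnerProductSpace ℝ E] [FiniteDimensional ℝ E]
  [MeasurableSpace E] [BorelSpace E] {μ : Measure E}

/-- A function whose products with all Schwartz functions are integrable is integrable against a
polynomial weight. -/
theorem exists_lintegral_mul_polyWeight_lt_top {f : E → ℂ} (hf : AEStronglyMeasurable f μ)
    (h : ∀ ψ : 𝓢(E, ℂ), Integrable (fun x => f x * ψ x) μ) :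
    ∃ N : ℝ, 0 ≤ N ∧ ∫⁻ x, ‖f x‖ₑ * polyWeight N x ∂μ < ∞ := by
  by_cases hgrow : ∃ N : ℕ, ∃ C : ℝ≥0∞, C ≠ ∞ ∧ ∀ j : ℕ,
      ∫⁻ x in Metric.ball (0 : E) (2 ^ j), ‖f x‖ₑ ∂μ ≤ C * 2 ^ (j * N)
  · obtain ⟨N, C, hC, hN⟩ := hgrow
    exact ⟨_, Nat.cast_nonneg _, lintegral_mul_polyWeight_lt_top_of_dyadic hf hC hN⟩
  exfalso
  push Not at hgrow
  -- If growth fails at every order, use the failure at order `m` with constant `4^m` to build one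
  -- Schwartz function `Ψ`, a series of bumps of radius about `2^(j m)`. The heights `c m` give each
  -- a mass against `|f|` of at least `4^m 2^(j m * m) c m = 2^m`.
  choose j hj using fun m : ℕ => hgrow m (4 ^ m) (by finiteness)
  set c : ℕ → ℝ := fun m => ((2 : ℝ) ^ (j m * m + m))⁻¹ with hc
  have hc0 : ∀ m, 0 < c m := fun m => by positivity
  have hR : ∀ m, (1 : ℝ) ≤ 2 ^ j m := fun m => one_le_pow₀ one_le_two
  choose D hD0 hD using exists_pow_mul_norm_iteratedFDeriv_cutoff_le E
  set ψ : ℕ → E → ℂ := fun m x => (c m : ℂ) * cutoff (2 ^ j m) x with hψ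
  set v : ℕ → ℕ → ℕ → ℝ := fun k l m => c m * (D k l * (2 ^ j m) ^ k) with hv
  have hv0 : ∀ k l m, 0 ≤ v k l m := fun k l m => by have := hD0 k l; positivity
  have hb : ∀ k l m x, ‖x‖ ^ k * ‖iteratedFDeriv ℝ l (ψ m) x‖ ≤ v k l m := by
    intro k l m x
    have h1 : iteratedFDeriv ℝ l (ψ m) x = c m • iteratedFDeriv ℝ l (cutoff (2 ^ j m)) x := by
      rw [← iteratedFDeriv_const_smul_apply
        ((contDiff_cutoff _).of_le (by exact_mod_cast le_top)).contDiffAt]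
      congr 1
    rw [h1, norm_smul, Real.norm_of_nonneg (hc0 m).le]
    calc _ = c m * (‖x‖ ^ k * ‖iteratedFDeriv ℝ l (cutoff (2 ^ j m)) x‖) := by ring
      _ ≤ _ := by
        exact mul_le_mul_of_nonneg_left (hD k l _ (hR m) x) (hc0 m).le
  have hvs : ∀ k l, Summable (v k l) := by
    intro k l
    refine Summable.of_norm_bounded_eventually_nat (g := fun m => D k l * (1 / 2 : ℝ) ^ m)
      (summable_geometric_two.mul_left _) ?_
    -- For `m ≥ k` the factor `2^(-(j m * m))` absorbs the seminorm growth `2^(j m * k)`, leaving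
    -- `2^(-m)`.
    filter_upwards [eventually_ge_atTop k] with m hm
    rw [Real.norm_of_nonneg (hv0 k l m)]
    have h1 : c m * (2 ^ j m) ^ k ≤ (1 / 2 : ℝ) ^ m := by
      rw [hc, ← pow_mul, one_div, inv_pow, inv_mul_le_iff₀ (by positivity), ← div_eq_mul_inv,
        le_div_iff₀ (by positivity), ← pow_add]
      exact pow_le_pow_right₀ one_le_two (by nlinarith [Nat.mul_le_mul_left (j m) hm])
    calc v k l m = D k l * (c m * (2 ^ j m) ^ k) := by simp only [hv]; ring
      _ ≤ _ := by have := hD0 k l; gcongr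
  obtain ⟨Ψ, hΨ⟩ := exists_schwartzMap_eq_tsum ψ
    (fun m => contDiff_const.mul (contDiff_cutoff _)) v hvs hb
  -- All terms of the series are nonnegative reals, so its sum dominates the `m`-th one, equal to `c
  -- m` on this ball.
  have hlow : ∀ m x, x ∈ Metric.ball (0 : E) (2 ^ j m) → c m ≤ ‖Ψ x‖ := by
    intro m x hx
    set r : ℕ → ℝ := fun m => c m * stdBump E (((2 : ℝ) ^ j m)⁻¹ • x) with hr
    have hψr : ∀ m, ψ m x = (r m : ℂ) := fun m => by simp [hψ, hr, cutoff]
    have hr0 : ∀ m, 0 ≤ r m := fun m => mul_nonneg (hc0 m).le (stdBump E).nonneg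
    have hrs : Summable r := (hvs 0 0).of_nonneg_of_le hr0 fun m => by
      have := hb 0 0 m x
      rw [norm_iteratedFDeriv_zero, hψr, Complex.norm_real, Real.norm_of_nonneg (hr0 m)] at this
      simpa using this
    have hrm : r m = c m := by
      have h1 := cutoff_eq_one (lt_of_lt_of_le one_pos (hR m)) (x := x)
        (by rw [mem_ball_zero_iff] at hx; linarith [hR m])
      rw [cutoff, Complex.ofReal_eq_one] at h1
      simp [hr, h1]
    rw [hΨ, tsum_congr hψr, ← Complex.ofReal_tsum, Complex.norm_real,
      Real.norm_of_nonneg (tsum_nonneg hr0), ← hrm]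
    exact hrs.le_tsum m fun i _ => hr0 i
  have hfin : ∫⁻ x, ‖f x * Ψ x‖ₑ ∂μ < ∞ := (h Ψ).hasFiniteIntegral
  have hbig : ∀ m : ℕ, (2 : ℝ≥0∞) ^ m ≤ ∫⁻ x, ‖f x * Ψ x‖ₑ ∂μ := by
    intro m
    have hce : ENNReal.ofReal (c m) = ((2 : ℝ≥0∞) ^ (j m * m + m))⁻¹ := by
      rw [hc, ENNReal.ofReal_inv_of_pos (by positivity), ENNReal.ofReal_pow (by positivity)]
      simp
    calc (2 : ℝ≥0∞) ^ m = (4 ^ m * 2 ^ (j m * m)) * ENNReal.ofReal (c m) := by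
          rw [hce, ← div_eq_mul_inv, ENNReal.eq_div_iff (by simp) (by finiteness),
            show (4 : ℝ≥0∞) = 2 * 2 by norm_num, mul_pow, pow_add]
          ring
      _ ≤ (∫⁻ x in Metric.ball (0 : E) (2 ^ j m), ‖f x‖ₑ ∂μ) * ENNReal.ofReal (c m) := by
          gcongr; exact (hj m).le
      _ = ∫⁻ x in Metric.ball (0 : E) (2 ^ j m), ‖f x‖ₑ * ENNReal.ofReal (c m) ∂μ :=
          (lintegral_mul_const' _ _ ENNReal.ofReal_ne_top).symm
      _ ≤ ∫⁻ x in Metric.ball (0 : E) (2 ^ j m), ‖f x * Ψ x‖ₑ ∂μ := by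
          refine setLIntegral_mono' Metric.isOpen_ball.measurableSet fun x hx => ?_
          rw [enorm_mul, ← ofReal_norm (Ψ x)]
          gcongr; exact hlow m x hx
      _ ≤ _ := setLIntegral_le_lintegral _ _
  obtain ⟨m, hm⟩ := ENNReal.exists_nat_gt hfin.ne
  have h2 : (m : ℝ≥0∞) ≤ 2 ^ m := by exact_mod_cast (Nat.lt_two_pow_self (n := m)).le
  exact absurd (hbig m) (not_le.2 (hm.trans_le h2))

end TemperedGrowth

/-! ### Convolution of a function of polynomial growth with a decaying kernel. -/

section WeightedConvolution

open scoped Topology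
open Filter

variable {E : Type*} [NormedAddCommGroup E]

theorem polyWeight_sub_le {N : ℝ} (hN : 0 ≤ N) (z x : E) :
    polyWeight N (z - x) ≤ polyWeight (-N) z * polyWeight N x := by
  have h := polyWeight_mul_le hN (z - x) (-z)
  rw [polyWeight_neg, show z - x + -z = -x by abel, polyWeight_neg] at h
  rw [← polyWeight_inv, mul_comm, ← div_eq_mul_inv, ENNReal.le_div_iff_mul_le
    (Or.inl (polyWeight_ne_zero _ _)) (Or.inl (polyWeight_ne_top _ _))]
  exact h

variable [MeasurableSpace E] {μ : Measure E}

/-- Supplies the pointwise polynomial growth needed to start the Peetre bootstrap. -/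
theorem enorm_integral_mul_sub_le {N : ℝ} (hN : 0 ≤ N) {f K : E → ℂ} {C : ℝ≥0∞} (hC : C ≠ ∞)
    (hK : ∀ x, ‖K x‖ₑ ≤ C * polyWeight N x) (z : E) :
    ‖∫ x, f x * K (z - x) ∂μ‖ₑ * polyWeight N z ≤ C * ∫⁻ x, ‖f x‖ₑ * polyWeight N x ∂μ := by
  refine (mul_le_mul_left (enorm_integral_le_lintegral_enorm _) _).trans ?_
  rw [← lintegral_const_mul' _ _ hC, ← lintegral_mul_const' _ _ (polyWeight_ne_top _ _)]
  refine lintegral_mono fun x => ?_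
  rw [enorm_mul]
  calc _ ≤ ‖f x‖ₑ * (C * (polyWeight (-N) z * polyWeight N x)) * polyWeight N z := by
        gcongr
        exact (hK _).trans (by gcongr; exact polyWeight_sub_le hN z x)
    _ = C * (‖f x‖ₑ * polyWeight N x) * (polyWeight (-N) z * polyWeight N z) := by ring
    _ = _ := by
      rw [← polyWeight_inv, ENNReal.inv_mul_cancel (polyWeight_ne_zero _ _)
        (polyWeight_ne_top _ _), mul_one]

theorem continuous_integral_mul_sub [BorelSpace E] [SecondCountableTopology E] {N : ℝ} (hN : 0 ≤ N)
    {f K : E → ℂ} (hf : AEStronglyMeasurable f μ) (hK : Continuous K)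
    (hfN : ∫⁻ x, ‖f x‖ₑ * polyWeight N x ∂μ < ∞) {C : ℝ≥0∞} (hC : C ≠ ∞)
    (hKC : ∀ x, ‖K x‖ₑ ≤ C * polyWeight N x) :
    Continuous fun z => ∫ x, f x * K (z - x) ∂μ := by
  refine continuous_iff_continuousAt.2 fun z₀ => ?_
  have hev : ∀ᶠ z in 𝓝 z₀, polyWeight (-N) z < polyWeight (-N) z₀ + 1 :=
    (continuous_polyWeight (-N)).continuousAt.eventually
      (gt_mem_nhds (ENNReal.lt_add_right (polyWeight_ne_top _ _) one_ne_zero))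
  set D : ℝ≥0∞ := C * (polyWeight (-N) z₀ + 1) with hD
  have hDt : D ≠ ∞ := ENNReal.mul_ne_top hC (by simp [polyWeight_ne_top])
  have hmeas : AEMeasurable (fun x => D * (‖f x‖ₑ * polyWeight N x)) μ :=
    (hf.enorm.mul (continuous_polyWeight N).measurable.aemeasurable).const_mul _
  have hfin : ∫⁻ x, D * (‖f x‖ₑ * polyWeight N x) ∂μ ≠ ∞ := by
    rw [lintegral_const_mul' _ _ hDt]
    exact ENNReal.mul_ne_top hDt hfN.ne
  refine continuousAt_of_dominated (bound := fun x => (D * (‖f x‖ₑ * polyWeight N x)).toReal)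
    (Eventually.of_forall fun z => hf.mul
      (hK.comp (continuous_const.sub continuous_id)).aestronglyMeasurable) ?_
    (integrable_toReal_of_lintegral_ne_top hmeas hfin)
    (Eventually.of_forall fun x => by fun_prop)
  filter_upwards [hev] with z hz
  refine Eventually.of_forall fun x => ?_
  rw [← toReal_enorm]
  refine ENNReal.toReal_mono (ENNReal.mul_ne_top hDt
    (ENNReal.mul_ne_top enorm_ne_top (polyWeight_ne_top _ _))) ?_
  rw [enorm_mul]
  calc _ ≤ ‖f x‖ₑ * (C * ((polyWeight (-N) z₀ + 1) * polyWeight N x)) := by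
        gcongr
        exact (hKC _).trans (by gcongr; exact (polyWeight_sub_le hN z x).trans (by gcongr))
    _ = _ := by rw [hD]; ring

theorem locallyIntegrable_of_lintegral_mul_polyWeight [BorelSpace E] [LocallyCompactSpace E] {N : ℝ}
    {f : E → ℂ} (hf : AEStronglyMeasurable f μ)
    (hfN : ∫⁻ x, ‖f x‖ₑ * polyWeight N x ∂μ < ∞) : LocallyIntegrable f μ := by
  refine locallyIntegrable_iff.2 fun k hk => ⟨hf.restrict, ?_⟩
  obtain ⟨c, hc, hck⟩ : ∃ c : ℝ≥0∞, c ≠ ∞ ∧ ∀ x ∈ k, polyWeight (-N) x ≤ c := by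
    rcases k.eq_empty_or_nonempty with rfl | hne
    · exact ⟨0, by simp, by simp⟩
    obtain ⟨x, _, hx⟩ := hk.exists_isMaxOn hne (continuous_polyWeight (-N)).continuousOn
    exact ⟨_, polyWeight_ne_top (-N) x, fun y hy => hx hy⟩
  calc ∫⁻ x in k, ‖f x‖ₑ ∂μ ≤ ∫⁻ x in k, c * (‖f x‖ₑ * polyWeight N x) ∂μ := by
        refine setLIntegral_mono_ae' hk.measurableSet (Eventually.of_forall fun x hx => ?_)
        calc ‖f x‖ₑ = ‖f x‖ₑ * ((polyWeight N x)⁻¹ * polyWeight N x) := by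
              rw [ENNReal.inv_mul_cancel (polyWeight_ne_zero _ _) (polyWeight_ne_top _ _), mul_one]
          _ ≤ ‖f x‖ₑ * (c * polyWeight N x) := by
              rw [polyWeight_inv]; gcongr; exact hck x hx
          _ = _ := by ring
    _ ≤ ∫⁻ x, c * (‖f x‖ₑ * polyWeight N x) ∂μ := setLIntegral_le_lintegral _ _
    _ < ∞ := by rw [lintegral_const_mul' _ _ hc]; exact ENNReal.mul_lt_top hc.lt_top hfN

end WeightedConvolution

/-! ### Reproducing formula for band-limited functions. -/

section BandLimited

open scoped Convolution
open Filter Distribution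

theorem SchwartzMap.exists_enorm_le_polyWeight {E : Type*} [NormedAddCommGroup E]
    [NormedSpace ℝ E] (ψ : 𝓢(E, ℂ)) (c : ℝ) :
    ∃ C : ℝ≥0∞, C ≠ ∞ ∧ ∀ x, ‖ψ x‖ₑ ≤ C * polyWeight c x := by
  set k := ⌈c⌉₊
  set D : ℝ := 2 ^ k * (Finset.Iic (k, 0)).sup (fun m => SchwartzMap.seminorm ℝ m.1 m.2) ψ with hD
  refine ⟨ENNReal.ofReal D, ENNReal.ofReal_ne_top, fun x => ?_⟩
  have h := SchwartzMap.one_add_le_sup_seminorm_apply (𝕜 := ℝ) (m := (k, 0)) le_rfl le_rfl ψ x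
  rw [norm_iteratedFDeriv_zero] at h
  have hD0 : 0 ≤ D := le_trans (by positivity) h
  refine le_trans ?_ (mul_le_mul_right (polyWeight_anti (Nat.le_ceil c) x) _)
  rw [polyWeight, ← ENNReal.ofReal_mul hD0, ← ofReal_norm]
  refine ENNReal.ofReal_le_ofReal ?_
  rw [Real.rpow_neg (by positivity), Real.rpow_natCast, ← div_eq_mul_inv,
    le_div_iff₀ (by positivity), mul_comm]
  exact h

variable {E : Type*} [NormedAddCommGroup E] [InnerProductSpace ℝ E] [FiniteDimensional ℝ E]
  [MeasurableSpace E] [BorelSpace E]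

variable (E) in
/-- A Schwartz function whose Fourier transform equals `1` on the ball of radius `2`. -/
def reproducingKernel : 𝓢(E, ℂ) :=
  𝓕⁻ ((hasCompactSupport_cutoff (E := E) one_pos).toSchwartzMap (contDiff_cutoff 1))

/-- Identifies the adjoint of convolution with the reproducing kernel as a Fourier cutoff. Two
inverse transforms reflect `ψ`, so the convolution theorem is applied to the reflection and
evaluated at `-x`. -/
theorem fourier_cutoff_smul_fourierInv_apply (ψ : 𝓢(E, ℂ)) (x : E) :
    𝓕 (SchwartzMap.smulLeftCLM ℂ (cutoff (1 : ℝ)) (𝓕⁻ ψ)) x =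
      ∫ z, reproducingKernel E (z - x) * ψ z := by
  set B := ContinuousLinearMap.mul ℂ ℂ
  have h1 : SchwartzMap.convolution B (reproducingKernel E) (𝓕⁻ (𝓕⁻ ψ)) =
      𝓕⁻ (SchwartzMap.smulLeftCLM ℂ (cutoff (1 : ℝ)) (𝓕⁻ ψ)) := by
    have h0 : ∀ φ : 𝓢(E, ℂ), 𝓕⁻ (𝓕 φ : 𝓢(E, ℂ)) = φ := fun φ =>
      FourierTransform.fourierInv_fourier_eq φ
    rw [← h0 (SchwartzMap.convolution B _ _), SchwartzMap.fourier_convolution]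
    congr 1
    ext y
    rw [SchwartzMap.pairing_apply_apply, reproducingKernel, FourierTransform.fourier_fourierInv_eq,
      FourierTransform.fourier_fourierInv_eq,
      SchwartzMap.smulLeftCLM_apply_apply (hasTemperateGrowth_cutoff one_pos)]
    rfl
  have h2 : ∀ (φ : 𝓢(E, ℂ)) (y : E), (𝓕⁻ φ) y = (𝓕 φ) (-y) := fun φ y => rfl
  have h3 : ∀ y : E, (𝓕⁻ (𝓕⁻ ψ)) y = ψ (-y) := by
    intro y
    rw [h2, FourierTransform.fourier_fourierInv_eq]
  have h4 := congrArg (fun φ : 𝓢(E, ℂ) => φ (-x)) h1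
  simp only [SchwartzMap.convolution_apply] at h4
  rw [h2, neg_neg] at h4
  rw [← h4, convolution]
  rw [← integral_sub_right_eq_self _ x]
  refine integral_congr_ae (Eventually.of_forall fun z => ?_)
  simp only [h3, B, ContinuousLinearMap.mul_apply']
  congr 2
  abel

/-- The cutoff is `1` on the ball of radius `2`, so what it removes from `𝓕⁻ ψ` is invisible to `𝓕
u`. -/
theorem apply_eq_apply_of_dsupport_fourier_subset (u : 𝓢'(E, ℂ))
    (hu : dsupport (𝓕 u : 𝓢'(E, ℂ)) ⊆ Metric.closedBall 0 1) (ψ : 𝓢(E, ℂ)) :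
    u ψ = u (𝓕 (SchwartzMap.smulLeftCLM ℂ (cutoff (1 : ℝ)) (𝓕⁻ ψ))) := by
  have h := apply_eq_zero_of_eq_zero_on_ball (𝓕 u : 𝓢'(E, ℂ)) hu
    (𝓕⁻ ψ - SchwartzMap.smulLeftCLM ℂ (cutoff (1 : ℝ)) (𝓕⁻ ψ)) (fun x hx => by
      rw [sub_apply, SchwartzMap.smulLeftCLM_apply_apply (hasTemperateGrowth_cutoff one_pos),
        cutoff_eq_one one_pos (by linarith)]
      simp)
  rw [map_sub, TemperedDistribution.fourier_apply, TemperedDistribution.fourier_apply,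
    FourierTransform.fourier_fourierInv_eq, sub_eq_zero] at h
  exact h

/-- A function whose Fourier transform is supported in the unit ball agrees almost everywhere with
its convolution with the reproducing kernel. -/
theorem ae_eq_integral_mul_reproducingKernel {f : E → ℂ} (hf : AEStronglyMeasurable f)
    {N : ℝ} (hN : 0 ≤ N) (hfN : ∫⁻ x, ‖f x‖ₑ * polyWeight N x < ∞) (u : 𝓢'(E, ℂ))
    (hfu : ∀ ψ : 𝓢(E, ℂ), u ψ = ∫ x, f x * ψ x)
    (hu : dsupport (𝓕 u : 𝓢'(E, ℂ)) ⊆ Metric.closedBall 0 1) :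
    f =ᵐ[volume] fun z => ∫ x, f x * reproducingKernel E (z - x) := by
  obtain ⟨C, hC, hK⟩ := (reproducingKernel E).exists_enorm_le_polyWeight N
  -- By duality it suffices to pair both sides with real test functions; Fubini, justified by
  -- `hint`, then moves the kernel from the test function to `f`.
  refine ae_eq_of_integral_contDiff_smul_eq
    (locallyIntegrable_of_lintegral_mul_polyWeight hf hfN)
    (continuous_integral_mul_sub hN hf (reproducingKernel E).continuous hfN hC
      hK).locallyIntegrable fun g hg hgc => ?_
  set ψ : 𝓢(E, ℂ) := HasCompactSupport.toSchwartzMap (f := fun x => ((g x : ℝ) : ℂ))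
    (hgc.comp_left Complex.ofReal_zero) (Complex.ofRealCLM.contDiff.comp hg) with hψ
  have hψg : ∀ x, ψ x = (g x : ℂ) := fun x => rfl
  have hint : Integrable (Function.uncurry fun x z => f x * (reproducingKernel E (z - x) * ψ z))
      (volume.prod volume) := by
    obtain ⟨C', hC', hψC⟩ := ψ.exists_enorm_le_polyWeight (N + (Module.finrank ℝ E + 1))
    have hm : AEStronglyMeasurable
        (Function.uncurry fun x z => f x * (reproducingKernel E (z - x) * ψ z))
        (volume.prod volume) :=
      hf.comp_fst.mul (((reproducingKernel E).continuous.comp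
        (continuous_snd.sub continuous_fst)).mul
          (ψ.continuous.comp continuous_snd)).aestronglyMeasurable
    refine ⟨hm, ?_⟩
    have hb : ∀ q : E × E, ‖Function.uncurry
        (fun x z => f x * (reproducingKernel E (z - x) * ψ z)) q‖ₑ ≤
        (‖f q.1‖ₑ * polyWeight N q.1) * (C * C' * polyWeight (Module.finrank ℝ E + 1 : ℝ) q.2) := by
      rintro ⟨x, z⟩
      simp only [Function.uncurry_apply_pair, enorm_mul]
      calc _ ≤ ‖f x‖ₑ * (C * (polyWeight (-N) z * polyWeight N x) *
              (C' * polyWeight (N + (Module.finrank ℝ E + 1)) z)) := by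
            gcongr
            · exact (hK _).trans (by gcongr; exact polyWeight_sub_le hN z x)
            · exact hψC z
        _ = (‖f x‖ₑ * polyWeight N x) * (C * C' *
              (polyWeight (-N) z * polyWeight (N + (Module.finrank ℝ E + 1)) z)) := by ring
        _ = _ := by
            rw [← polyWeight_add]; ring_nf
    refine (lintegral_mono hb).trans_lt ?_
    have hm1 : AEMeasurable (fun x => ‖f x‖ₑ * polyWeight N x) volume :=
      hf.enorm.mul (continuous_polyWeight N).measurable.aemeasurable
    rw [lintegral_prod_mul hm1 ((continuous_polyWeight _).measurable.aemeasurable.const_mul _),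
      lintegral_const_mul _ (continuous_polyWeight _).measurable]
    exact ENNReal.mul_lt_top hfN (ENNReal.mul_lt_top (ENNReal.mul_lt_top hC.lt_top hC'.lt_top)
      (lintegral_polyWeight_lt_top volume (by simp)))
  calc ∫ x, g x • f x = u ψ := by
        rw [hfu]
        refine integral_congr_ae (Eventually.of_forall fun x => ?_)
        simp [hψg, mul_comm]
    _ = ∫ x, f x * ∫ z, reproducingKernel E (z - x) * ψ z := by
        rw [apply_eq_apply_of_dsupport_fourier_subset u hu, hfu]
        simp_rw [fourier_cutoff_smul_fourierInv_apply]
    _ = ∫ x, ∫ z, f x * (reproducingKernel E (z - x) * ψ z) := by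
        simp_rw [integral_const_mul]
    _ = ∫ z, ∫ x, f x * (reproducingKernel E (z - x) * ψ z) := integral_integral_swap hint
    _ = _ := by
        refine integral_congr_ae (Eventually.of_forall fun z => ?_)
        simp only [hψg, ← mul_assoc, integral_mul_const]
        rw [mul_comm, Complex.real_smul]

end BandLimited

/-! ### Geometry and uniform bounds of the rescaled kernels. -/

section Kernel

variable {n : ℕ}

/-- The diagonal matrix of the anisotropic rescaling `x ↦ (x₁/(tδ), …, x_{n-1}/(tδ), xₙ/t)`. -/
def rescaleMatrix (n : ℕ) (δ t : ℝ) : Matrix (Fin n) (Fin n) ℝ :=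
  Matrix.diagonal fun i : Fin n => if i.val + 1 = n then t⁻¹ else t⁻¹ / δ

/-- The rescaling composed with a matrix, as a linear map of Euclidean space. -/
def rescaleLin (δ t : ℝ) (B : Matrix (Fin n) (Fin n) ℝ) : RSpace n →ₗ[ℝ] RSpace n :=
  Matrix.toEuclideanLin (rescaleMatrix n δ t * B)

theorem det_rescaleMatrix (hn : 1 ≤ n) (δ t : ℝ) :
    (rescaleMatrix n δ t).det = 1 / t ^ n * (1 / δ) ^ (n - 1) := by
  obtain ⟨m, rfl⟩ := Nat.exists_eq_add_of_le' hn
  rw [rescaleMatrix, Matrix.det_diagonal, Fin.prod_univ_castSucc]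
  have h : ∀ i : Fin m, (i.castSucc : Fin (m + 1)).val + 1 ≠ m + 1 := fun i => by
    simp [i.isLt.ne]
  simp only [h, if_false, Fin.val_last, if_true, Finset.prod_const, Finset.card_univ,
    Fintype.card_fin, Nat.add_sub_cancel]
  rw [div_pow, div_pow, one_pow, inv_pow, pow_succ]
  rcases eq_or_ne t 0 with rfl | ht
  · simp
  · field_simp

theorem abs_det_rescaleLin (hn : 1 ≤ n) {δ t : ℝ} (hδ : 0 < δ) (ht : 0 < t)
    {B : Matrix (Fin n) (Fin n) ℝ} (hB : B ∈ Matrix.orthogonalGroup (Fin n) ℝ) :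
    |LinearMap.det (rescaleLin δ t B)| = 1 / t ^ n * (1 / δ) ^ (n - 1) := by
  have h1 : |B.det| = 1 := by
    have h2 := congrArg Matrix.det ((Matrix.mem_orthogonalGroup_iff' _ _).1 hB)
    rw [Matrix.det_mul, Matrix.det_transpose, Matrix.det_one] at h2
    rw [← sq_eq_sq₀ (abs_nonneg _) zero_le_one, sq_abs]
    linarith [sq B.det]
  rw [rescaleLin, Matrix.toEuclideanLin_eq_toLin_orthonormal, LinearMap.det_toLin,
    Matrix.det_mul, abs_mul, h1, mul_one, det_rescaleMatrix hn, abs_of_pos (by positivity)]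

theorem norm_toEuclideanLin_of_mem_orthogonalGroup {B : Matrix (Fin n) (Fin n) ℝ}
    (hB : B ∈ Matrix.orthogonalGroup (Fin n) ℝ) (y : RSpace n) :
    ‖Matrix.toEuclideanLin B y‖ = ‖y‖ := by
  rw [← sq_eq_sq₀ (norm_nonneg _) (norm_nonneg _), EuclideanSpace.real_norm_sq_eq,
    EuclideanSpace.real_norm_sq_eq]
  have h : ∀ v : Fin n → ℝ, ∑ i, v i ^ 2 = v ⬝ᵥ v := fun v => by
    simp [dotProduct, sq]
  rw [h, h]
  change (B.mulVec y.ofLp) ⬝ᵥ (B.mulVec y.ofLp) = _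
  rw [Matrix.dotProduct_mulVec, Matrix.vecMul_mulVec,
    (Matrix.mem_orthogonalGroup_iff' _ _).1 hB, Matrix.vecMul_one]

/-- All diagonal entries of the rescaling are at least `1/t`, as `δ < 1`, and the orthogonal factor
preserves norms. This is why no power of `1/δ` is lost. -/
theorem norm_le_mul_norm_rescaleLin {δ t : ℝ} (hδ : 0 < δ) (hδ1 : δ < 1) (ht : 0 < t)
    {B : Matrix (Fin n) (Fin n) ℝ} (hB : B ∈ Matrix.orthogonalGroup (Fin n) ℝ) (y : RSpace n) :
    ‖y‖ ≤ t * ‖rescaleLin δ t B y‖ := by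
  rw [← norm_toEuclideanLin_of_mem_orthogonalGroup hB y]
  have hcoord : ∀ i, (rescaleLin δ t B y) i =
      (if i.val + 1 = n then t⁻¹ else t⁻¹ / δ) * (Matrix.toEuclideanLin B y) i := by
    intro i
    change ((rescaleMatrix n δ t * B).mulVec y.ofLp) i = _ * (B.mulVec y.ofLp) i
    rw [← Matrix.mulVec_mulVec, rescaleMatrix, Matrix.mulVec_diagonal]
  have hsmul : t * ‖rescaleLin δ t B y‖ = ‖t • rescaleLin δ t B y‖ := by
    rw [norm_smul, Real.norm_of_nonneg ht.le]
  rw [hsmul, ← sq_le_sq₀ (norm_nonneg _) (norm_nonneg _), EuclideanSpace.real_norm_sq_eq,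
    EuclideanSpace.real_norm_sq_eq]
  refine Finset.sum_le_sum fun i _ => ?_
  rw [PiLp.smul_apply, smul_eq_mul, hcoord, ← mul_assoc, mul_pow]
  refine le_mul_of_one_le_left (sq_nonneg _) (one_le_pow₀ ?_)
  split_ifs
  · rw [mul_inv_cancel₀ ht.ne']
  · rw [← mul_div_assoc, mul_inv_cancel₀ ht.ne']
    exact (one_le_div hδ).2 hδ1.le

theorem dilate_anisotropic_eq {δ t : ℝ} (hδ : 0 < δ) (ht : 0 < t) (hn : 1 ≤ n)
    {B : Matrix (Fin n) (Fin n) ℝ} (hB : B ∈ Matrix.orthogonalGroup (Fin n) ℝ)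
    (Υ : RSpace n → ℂ) (y : RSpace n) :
    dilate t (anisotropic δ Υ) (Matrix.toEuclideanLin B y) =
      ((|LinearMap.det (rescaleLin δ t B)| : ℝ) : ℂ) * Υ (rescaleLin δ t B y) := by
  rw [abs_det_rescaleLin hn hδ ht hB, dilate, anisotropic, ← mul_assoc, ← Complex.ofReal_mul]
  congr 2
  ext i
  change _ = ((rescaleMatrix n δ t * B).mulVec y.ofLp) i
  rw [← Matrix.mulVec_mulVec, rescaleMatrix, Matrix.mulVec_diagonal]
  change (if i.val + 1 = n then t⁻¹ * (B.mulVec y.ofLp) i else t⁻¹ * (B.mulVec y.ofLp) i / δ) = _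
  split_ifs
  · rfl
  · ring

theorem polyWeight_le_mul_polyWeight_of_norm_le {E F : Type*} [NormedAddCommGroup E]
    [NormedAddCommGroup F] {b t : ℝ} (hb : 0 ≤ b) (ht : 0 ≤ t) {x : E} {y : F}
    (h : ‖x‖ ≤ t * ‖y‖) :
    polyWeight (-b) x ≤ ENNReal.ofReal ((1 + t) ^ b) * polyWeight (-b) y := by
  unfold polyWeight
  rw [← ENNReal.ofReal_mul (by positivity), neg_neg,
    ← Real.mul_rpow (by positivity) (by positivity)]
  refine ENNReal.ofReal_le_ofReal (Real.rpow_le_rpow (by positivity) ?_ hb)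
  nlinarith [norm_nonneg y]

/-- Substituting `w = Λ y`, the Jacobian cancels the normalisation of the kernel exactly, and `1 +
|y| ≤ (1 + t)(1 + |Λ y|)` accounts for the weight. -/
theorem lintegral_polyWeight_mul_kernel_le {δ t : ℝ} (hδ : 0 < δ) (hδ1 : δ < 1) (ht : 0 < t)
    (hn : 1 ≤ n) {B : Matrix (Fin n) (Fin n) ℝ} (hB : B ∈ Matrix.orthogonalGroup (Fin n) ℝ)
    {b : ℝ} (hb : 0 ≤ b) {Υ : RSpace n → ℂ} (hΥ : Continuous Υ) :
    ∫⁻ y, polyWeight (-b) y * ‖dilate t (anisotropic δ Υ) (Matrix.toEuclideanLin B y)‖ₑ ≤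
      ENNReal.ofReal ((1 + t) ^ b) * ∫⁻ w, polyWeight (-b) w * ‖Υ w‖ₑ := by
  set Λ := rescaleLin δ t B with hΛ
  have hdet : LinearMap.det Λ ≠ 0 := by
    rw [← abs_pos, hΛ, abs_det_rescaleLin hn hδ ht hB]; positivity
  set d := ENNReal.ofReal |LinearMap.det Λ| with hd
  have hΛc : Continuous Λ := LinearMap.continuous_of_finiteDimensional Λ
  have hm : Measurable fun w : RSpace n => polyWeight (-b) w * ‖Υ w‖ₑ :=
    (continuous_polyWeight _).measurable.mul hΥ.measurable.enorm
  calc _ ≤ ∫⁻ y, (ENNReal.ofReal ((1 + t) ^ b) * d) * (polyWeight (-b) (Λ y) * ‖Υ (Λ y)‖ₑ) := by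
        refine lintegral_mono fun y => ?_
        rw [dilate_anisotropic_eq hδ ht hn hB, enorm_mul, ← ofReal_norm (Complex.ofReal _),
          Complex.norm_real, Real.norm_eq_abs, abs_abs]
        calc _ ≤ (ENNReal.ofReal ((1 + t) ^ b) * polyWeight (-b) (Λ y)) * (d * ‖Υ (Λ y)‖ₑ) := by
              gcongr
              exact polyWeight_le_mul_polyWeight_of_norm_le hb ht.le
                (norm_le_mul_norm_rescaleLin hδ hδ1 ht hB y)
          _ = _ := by ring
    _ = (ENNReal.ofReal ((1 + t) ^ b) * d) *
          ∫⁻ w, polyWeight (-b) w * ‖Υ w‖ₑ ∂(Measure.map Λ volume) := by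
        rw [lintegral_const_mul' _ _ (ENNReal.mul_ne_top ENNReal.ofReal_ne_top
          ENNReal.ofReal_ne_top), lintegral_map hm hΛc.measurable]
    _ = _ := by
        rw [Measure.map_linearMap_addHaar_eq_smul_addHaar _ hdet, lintegral_smul_measure,
          smul_eq_mul, mul_assoc, ← mul_assoc d, hd, ← ENNReal.ofReal_mul (abs_nonneg _),
          ← abs_mul, mul_inv_cancel₀ hdet]
        simp

theorem continuous_kernel (δ t : ℝ) {B : Matrix (Fin n) (Fin n) ℝ} {Υ : RSpace n → ℂ}
    (hδ : 0 < δ) (ht : 0 < t) (hn : 1 ≤ n) (hB : B ∈ Matrix.orthogonalGroup (Fin n) ℝ)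
    (hΥ : Continuous Υ) :
    Continuous fun y => dilate t (anisotropic δ Υ) (Matrix.toEuclideanLin B y) := by
  simp_rw [dilate_anisotropic_eq hδ ht hn hB]
  exact continuous_const.mul
    (hΥ.comp (LinearMap.continuous_of_finiteDimensional (rescaleLin δ t B)))

theorem exists_enorm_kernel_le {δ t : ℝ} (hδ : 0 < δ) (hδ1 : δ < 1) (ht : 0 < t) (hn : 1 ≤ n)
    {B : Matrix (Fin n) (Fin n) ℝ} (hB : B ∈ Matrix.orthogonalGroup (Fin n) ℝ)
    (Υ : 𝓢(RSpace n, ℂ)) {N : ℝ} (hN : 0 ≤ N) :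
    ∃ C : ℝ≥0∞, C ≠ ∞ ∧ ∀ y,
      ‖dilate t (anisotropic δ fun z => Υ z) (Matrix.toEuclideanLin B y)‖ₑ ≤
        C * polyWeight N y := by
  obtain ⟨C, hC, h⟩ := Υ.exists_enorm_le_polyWeight N
  set Λ := rescaleLin δ t B
  refine ⟨ENNReal.ofReal |LinearMap.det Λ| * (C * ENNReal.ofReal ((1 + t) ^ N)),
    by finiteness, fun y => ?_⟩
  rw [dilate_anisotropic_eq hδ ht hn hB, enorm_mul, ← ofReal_norm (Complex.ofReal _),
    Complex.norm_real, Real.norm_eq_abs, abs_abs, mul_assoc, mul_assoc]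
  gcongr
  refine (h _).trans ?_
  gcongr
  have h1 := polyWeight_le_mul_polyWeight_of_norm_le hN ht.le
    (norm_le_mul_norm_rescaleLin hδ hδ1 ht hB y)
  rw [← polyWeight_inv, ← polyWeight_inv, ← div_eq_mul_inv, ENNReal.le_div_iff_mul_le
    (Or.inl (polyWeight_ne_zero _ _)) (Or.inl (polyWeight_ne_top _ _)), mul_comm,
    ← div_eq_mul_inv] at h1
  exact (ENNReal.div_le_iff (polyWeight_ne_zero _ _) (polyWeight_ne_top _ _)).1 h1

theorem multiDeriv_zero (φ : 𝓢(RSpace n, ℂ)) : multiDeriv 0 φ = φ := by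
  simp only [multiDeriv, Pi.zero_apply, Function.iterate_zero, id_eq]
  induction List.finRange n with
  | nil => rfl
  | cons a l ih => simp [ih]

/-- The functions in the normalized class decay uniformly, at any order up to `|α|`. -/
theorem exists_enorm_le_of_mem_normalizedClass (n M : ℕ) :
    ∃ C : ℝ≥0∞, C ≠ ∞ ∧ ∀ α β : MultiIndex n, M ≤ α.order → ∀ Υ ∈ normalizedClass α β,
      ∀ w : RSpace n, ‖Υ w‖ₑ ≤ C * polyWeight M w := by
  refine ⟨ENNReal.ofReal (2 ^ M * (1 + (n : ℝ) ^ M)), ENNReal.ofReal_ne_top,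
    fun α β hα Υ hΥ w => ?_⟩
  have hpt : ∀ α' : MultiIndex n, α'.order ≤ α.order → |∏ i, w i ^ α' i| * ‖Υ w‖ ≤ 1 := by
    intro α' h
    have h1 := hΥ α' 0 h (by simp [MultiIndex.order])
    have h2 := (le_iSup (fun x : RSpace n =>
      ‖((∏ i, x i ^ α' i : ℝ) : ℂ) * multiDeriv 0 Υ x‖ₑ) w).trans h1
    rw [multiDeriv_zero, ← ofReal_norm, ENNReal.ofReal_le_one, norm_mul, Complex.norm_real] at h2
    exact h2
  have h0 : ‖Υ w‖ ≤ 1 := by simpa using hpt 0 (by simp [MultiIndex.order])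
  -- Testing with the pure power `M` in one coordinate is enough, since `|w|` is at most `n` times
  -- its largest coordinate.
  have hi : ∀ i, |w i| ^ M * ‖Υ w‖ ≤ 1 := by
    intro i
    have h := hpt (Pi.single i M) (by simpa [MultiIndex.order] using hα)
    rwa [Finset.prod_eq_single i (fun j _ hj => by simp [hj]) (by simp), Pi.single_eq_same,
      abs_pow] at h
  have hnorm : ‖w‖ ^ M * ‖Υ w‖ ≤ (n : ℝ) ^ M + 1 := by
    rcases n.eq_zero_or_pos with rfl | hn
    · rw [Subsingleton.elim w 0, norm_zero]
      rw [Subsingleton.elim w 0] at h0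
      have h3 : (0 : ℝ) ^ M ≤ 1 := pow_le_one₀ le_rfl zero_le_one
      have h4 : (0 : ℝ) ≤ 0 ^ M := by positivity
      push_cast
      nlinarith [norm_nonneg (Υ 0)]
    obtain ⟨i, -, hmax⟩ := Finset.exists_max_image Finset.univ (fun i => |w i|)
      ⟨⟨0, hn⟩, Finset.mem_univ _⟩
    have h3 : ‖w‖ ≤ n * |w i| := by
      rw [← sq_le_sq₀ (norm_nonneg _) (by positivity), EuclideanSpace.real_norm_sq_eq]
      calc ∑ j, w j ^ 2 ≤ ∑ j : Fin n, |w i| ^ 2 := by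
            refine Finset.sum_le_sum fun j hj => ?_
            rw [← sq_abs (w j)]
            exact pow_le_pow_left₀ (abs_nonneg _) (hmax j hj) 2
        _ = n * |w i| ^ 2 := by simp
        _ ≤ (n * |w i|) ^ 2 := by
            rw [mul_pow]
            gcongr
            exact le_self_pow₀ (Nat.one_le_cast.2 hn) two_ne_zero
    calc _ ≤ (n * |w i|) ^ M * ‖Υ w‖ := by gcongr
      _ = (n : ℝ) ^ M * (|w i| ^ M * ‖Υ w‖) := by ring
      _ ≤ (n : ℝ) ^ M * 1 := by gcongr; exact hi i
      _ ≤ _ := by linarith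
  have hsum : (1 + ‖w‖) ^ M * ‖Υ w‖ ≤ 2 ^ M * (1 + (n : ℝ) ^ M) := by
    rcases le_total ‖w‖ 1 with h | h
    · calc _ ≤ (2 : ℝ) ^ M * 1 := by gcongr; linarith
        _ ≤ _ := by gcongr; exact le_add_of_nonneg_right (by positivity)
    · calc _ ≤ (2 * ‖w‖) ^ M * ‖Υ w‖ := by gcongr; linarith
        _ = 2 ^ M * (‖w‖ ^ M * ‖Υ w‖) := by ring
        _ ≤ _ := by gcongr; linarith
  rw [polyWeight, ← ENNReal.ofReal_mul (by positivity), ← ofReal_norm]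
  refine ENNReal.ofReal_le_ofReal ?_
  rw [Real.rpow_neg (by positivity), Real.rpow_natCast, ← div_eq_mul_inv,
    le_div_iff₀ (by positivity), mul_comm]
  exact hsum

end Kernel

/-! ### Measurability and `L^p` bounds for the maximal function. -/

section MaximalFunction

variable {n : ℕ}

theorem inv_mem_orthogonalGroup (A : Matrix.orthogonalGroup (Fin n) ℝ) :
    ((A⁻¹ : Matrix.orthogonalGroup (Fin n) ℝ) : Matrix (Fin n) (Fin n) ℝ) ∈
      Matrix.orthogonalGroup (Fin n) ℝ := (A⁻¹).2

/-- Each average is continuous in `x`, so even the uncountable supremum is lower semicontinuous. -/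
theorem measurable_fixedScaleMaximal {δ t : ℝ} (hδ : 0 < δ) (hδ1 : δ < 1) (ht : 0 < t) (hn : 1 ≤ n)
    (α β : MultiIndex n) {f : RSpace n → ℂ} (hf : AEStronglyMeasurable f) {N : ℝ} (hN : 0 ≤ N)
    (hfN : ∫⁻ x, ‖f x‖ₑ * polyWeight N x < ∞) : Measurable (fixedScaleMaximal δ t α β f) := by
  refine LowerSemicontinuous.measurable (lowerSemicontinuous_iSup fun A =>
    lowerSemicontinuous_iSup fun Υ => lowerSemicontinuous_iSup fun _ =>
      Continuous.lowerSemicontinuous ?_)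
  refine Continuous.enorm ?_
  have hB := inv_mem_orthogonalGroup A
  obtain ⟨C, hC, h⟩ := exists_enorm_kernel_le hδ hδ1 ht hn hB Υ hN
  refine (continuous_integral_mul_sub hN hf (continuous_kernel δ t hδ ht hn hB Υ.continuous)
    hfN hC h).congr fun x => ?_
  rw [← integral_sub_left_eq_self _ volume x]
  simp only [sub_sub_cancel]

/-- The maximal function of a function is controlled pointwise by the Peetre maximal function of
any of its continuous representatives. -/
theorem fixedScaleMaximal_le {δ t : ℝ} (hδ : 0 < δ) (hδ1 : δ < 1) (ht : 0 < t) (hn : 1 ≤ n)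
    {α β : MultiIndex n} {f g : RSpace n → ℂ} (hfg : f =ᵐ[volume] g) {b : ℝ} (hb : 0 ≤ b)
    {D : ℝ≥0∞} (hD : ∀ Υ ∈ normalizedClass α β, ∫⁻ w, polyWeight (-b) w * ‖Υ w‖ₑ ≤ D)
    (x : RSpace n) :
    fixedScaleMaximal δ t α β f x ≤
      ENNReal.ofReal ((1 + t) ^ b) * D * peetreMaximal b g x := by
  refine iSup_le fun A => iSup_le fun Υ => iSup_le fun hΥ => ?_
  have hB := inv_mem_orthogonalGroup A
  have hker := lintegral_polyWeight_mul_kernel_le hδ hδ1 ht hn hB hb Υ.continuous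
  set K : RSpace n → ℂ := fun y => dilate t (anisotropic δ fun z => Υ z)
    (Matrix.toEuclideanLin ((A⁻¹ : Matrix.orthogonalGroup (Fin n) ℝ) :
      Matrix (Fin n) (Fin n) ℝ) y) with hK
  have hKm : Measurable K := (continuous_kernel δ t hδ ht hn hB Υ.continuous).measurable
  have hae : ∀ᵐ y, f (x - y) = g (x - y) :=
    (Measure.measurePreserving_sub_left volume x).quasiMeasurePreserving.ae_eq_comp hfg
  calc ‖∫ y, f (x - y) * K y‖ₑ = ‖∫ y, g (x - y) * K y‖ₑ := by
        congr 1
        refine integral_congr_ae (hae.mono fun y hy => ?_)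
        simp only [hy]
    _ ≤ ∫⁻ y, ‖g (x - y) * K y‖ₑ := enorm_integral_le_lintegral_enorm _
    _ ≤ ∫⁻ y, peetreMaximal b g x * (polyWeight (-b) y * ‖K y‖ₑ) := by
        refine lintegral_mono fun y => ?_
        have h := le_peetreMaximal b g x (x - y)
        rw [sub_sub_cancel] at h
        rw [enorm_mul, ← mul_assoc]
        gcongr
        rw [← polyWeight_inv, ← div_eq_mul_inv, ENNReal.le_div_iff_mul_le
          (Or.inl (polyWeight_ne_zero _ _)) (Or.inl (polyWeight_ne_top _ _))]
        exact h
    _ = peetreMaximal b g x * ∫⁻ y, polyWeight (-b) y * ‖K y‖ₑ :=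
        lintegral_const_mul _ ((continuous_polyWeight _).measurable.mul hKm.enorm)
    _ ≤ peetreMaximal b g x * (ENNReal.ofReal ((1 + t) ^ b) * D) := by
        gcongr
        exact hker.trans (by gcongr; exact hD Υ hΥ)
    _ = _ := mul_comm _ _

/-- The `L^p` bound for the maximal function of a band-limited function, with a constant depending
only on the dimension, on `p` and on the order `b` of the Peetre maximal function. -/
theorem exists_eLpNorm_fixedScaleMaximal_le (hn : 1 ≤ n) {p : ℝ} (hp : 0 < p) {b : ℝ} (hb : 0 ≤ b)
    (hbp : n < b * p) {M : ℕ} (hM : b + n < M) :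
    ∃ C : ℝ≥0∞, C ≠ ∞ ∧ ∀ α β : MultiIndex n, M ≤ α.order → ∀ δ t : ℝ, 0 < δ → δ < 1 → 0 < t →
      ∀ f : RSpace n → ℂ, MemLp f (ENNReal.ofReal p) volume →
        HasFourierSupportIn f (Metric.closedBall 0 1) →
        Measurable (fixedScaleMaximal δ t α β f) ∧
        eLpNorm (fixedScaleMaximal δ t α β f) (ENNReal.ofReal p) volume ≤
          ENNReal.ofReal ((1 + t) ^ b) * C * eLpNorm f (ENNReal.ofReal p) volume := by
  set η := reproducingKernel (RSpace n)
  obtain ⟨C₁, hC₁, hPeetre⟩ := exists_peetreMaximal_rpow_le (μ := (volume : Measure (RSpace n))) hp hb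
    η.exists_enorm_le_polyWeight
  obtain ⟨C₂, hC₂, hclass⟩ := exists_enorm_le_of_mem_normalizedClass n M
  set D : ℝ≥0∞ := C₂ * ∫⁻ w : RSpace n, polyWeight (M - b) w with hD
  have hDt : D ≠ ∞ := ENNReal.mul_ne_top hC₂
    (lintegral_polyWeight_lt_top volume (by rw [finrank_euclideanSpace_fin]; linarith)).ne
  set W : ℝ≥0∞ := C₁ * ∫⁻ x : RSpace n, polyWeight (b * p) x with hW
  have hWt : W ≠ ∞ := ENNReal.mul_ne_top hC₁
    (lintegral_polyWeight_lt_top volume (by rwa [finrank_euclideanSpace_fin])).ne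
  refine ⟨D * W ^ (1 / p), ENNReal.mul_ne_top hDt
    (ENNReal.rpow_ne_top_of_nonneg (by positivity) hWt), ?_⟩
  rintro α β hα δ t hδ hδ1 ht f hf ⟨u, hu, hsupp⟩
  obtain ⟨N, hN, hfN⟩ := exists_lintegral_mul_polyWeight_lt_top hf.1 fun ψ => (hu ψ).1
  refine ⟨measurable_fixedScaleMaximal hδ hδ1 ht hn α β hf.1 hN hfN, ?_⟩
  obtain ⟨C₃, hC₃, hη⟩ := η.exists_enorm_le_polyWeight N
  set g : RSpace n → ℂ := fun z => ∫ x, f x * η (z - x) with hg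
  have hfg : f =ᵐ[volume] g :=
    ae_eq_integral_mul_reproducingKernel hf.1 hN hfN u (fun ψ => (hu ψ).2) hsupp
  have hgm : Measurable g :=
    (continuous_integral_mul_sub hN hf.1 η.continuous hfN hC₃ hη).measurable
  -- Since `f = g` almost everywhere, `f` may be replaced by `g` inside the integral defining `g`,
  -- which makes `g` self-reproducing at every point.
  have hrepr : ∀ w, ‖g w‖ₑ ≤ ∫⁻ z, ‖g z‖ₑ * ‖η (w - z)‖ₑ := by
    intro w
    have h1 : g w = ∫ z, g z * η (w - z) :=
      integral_congr_ae (hfg.mono fun z hz => by simp only [hz])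
    rw [h1]
    refine (enorm_integral_le_lintegral_enorm _).trans_eq (lintegral_congr fun z => ?_)
    rw [enorm_mul]
  have hp0 : ENNReal.ofReal p ≠ 0 := by simpa using hp
  have hgp : eLpNorm g (ENNReal.ofReal p) volume =
      (∫⁻ z, ‖g z‖ₑ ^ p) ^ (1 / p) := by
    rw [eLpNorm_eq_lintegral_rpow_enorm_toReal hp0 ENNReal.ofReal_ne_top,
      ENNReal.toReal_ofReal hp.le]
  have hfin : ∫⁻ z, ‖g z‖ₑ ^ p ≠ ∞ := by
    intro htop
    rw [htop, ENNReal.top_rpow_of_pos (by positivity), ← eLpNorm_congr_ae hfg] at hgp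
    exact hf.2.ne hgp
  have hpw := hPeetre g hgm hrepr
    ⟨N, _, ENNReal.mul_ne_top hC₃ hfN.ne, enorm_integral_mul_sub_le hN hC₃ hη⟩ hfin
  have hmax := fixedScaleMaximal_le hδ hδ1 ht hn (α := α) (β := β) hfg hb (D := D)
    (fun Υ hΥ => by
      rw [hD, ← lintegral_const_mul' _ _ hC₂]
      refine lintegral_mono fun w => ?_
      calc _ ≤ polyWeight (-b) w * (C₂ * polyWeight M w) := by
            gcongr; exact hclass α β hα Υ hΥ w
        _ = C₂ * (polyWeight (-b) w * polyWeight M w) := by ring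
        _ = _ := by rw [← polyWeight_add, neg_add_eq_sub])
  set S : ℝ≥0∞ := ENNReal.ofReal ((1 + t) ^ b) * D
  have hSt : S ≠ ∞ := ENNReal.mul_ne_top ENNReal.ofReal_ne_top hDt
  rw [eLpNorm_congr_ae hfg, hgp, eLpNorm_eq_lintegral_rpow_enorm_toReal hp0 ENNReal.ofReal_ne_top,
      ENNReal.toReal_ofReal hp.le]
  calc _ ≤ (∫⁻ x, S ^ p * peetreMaximal b g x ^ p) ^ (1 / p) := by
        gcongr with x
        rw [enorm_eq_self, ← ENNReal.mul_rpow_of_nonneg _ _ hp.le]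
        exact ENNReal.rpow_le_rpow (hmax x) hp.le
    _ ≤ (S ^ p * (W * ∫⁻ z, ‖g z‖ₑ ^ p)) ^ (1 / p) := by
        rw [lintegral_const_mul' _ _ (ENNReal.rpow_ne_top_of_nonneg hp.le hSt)]
        gcongr
        exact lintegral_peetreMaximal_rpow_le hgm hpw
    _ = _ := by
        rw [ENNReal.mul_rpow_of_nonneg (S ^ p) _ (by positivity),
          ENNReal.mul_rpow_of_nonneg W _ (by positivity), ← ENNReal.rpow_mul,
          mul_one_div_cancel hp.ne', ENNReal.rpow_one]
        ring

end MaximalFunction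

end

/-! ### Choice of exponents. -/

theorem theorem3p4 (n : ℕ) (hn : 2 ≤ n) (p : ℝ) (hp : 0 < p) :
    ∃ α₀ β₀ : MultiIndex n, ∀ α β : MultiIndex n,
      α₀.order ≤ α.order → β₀.order ≤ β.order →
      ∀ ε : ℝ, 0 < ε → ∃ C : ℝ, 0 < C ∧
        ∀ r : ℝ, 0 < r → r < p →
        ∀ δ : ℝ, 0 < δ → δ < 1 →
        ∀ t : ℝ, 0 < t → t ≤ δ ^ (-ε) →
        ∀ f : RSpace n → ℂ, MemLp f (ENNReal.ofReal p) volume →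
          HasFourierSupportIn f (Metric.closedBall 0 1) →
          Measurable (fixedScaleMaximal δ t α β f) ∧
          eLpNorm (fixedScaleMaximal δ t α β f) (ENNReal.ofReal p) volume ≤
            ENNReal.ofReal (C * (1 / δ) ^ (4 * ((n : ℝ) / r + 1) * ε)) *
              eLpNorm f (ENNReal.ofReal p) volume := by
  have hn0 : (0 : ℝ) < n := by exact_mod_cast (by omega : 0 < n)
  -- The factor `2` gives `b p = 2n > n`, while `b ≤ 2n/r` for every `r < p`, well below `4(n/r +
  -- 1)`.
  set b : ℝ := 2 * (n : ℝ) / p with hb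
  have hb0 : 0 ≤ b := by positivity
  have hbp : (n : ℝ) < b * p := by rw [hb, div_mul_cancel₀ _ hp.ne']; linarith
  obtain ⟨M, hM⟩ := exists_nat_gt (b + n)
  obtain ⟨C, hC, h⟩ := exists_eLpNorm_fixedScaleMaximal_le (by omega : 1 ≤ n) hp hb0 hbp hM
  -- The constant multi-index has order `n M ≥ M`; adding `1` to `C.toReal` keeps the constant
  -- positive.
  refine ⟨fun _ => M, 0, fun α β hα _ ε hε => ⟨2 ^ b * (C.toReal + 1), by positivity, ?_⟩⟩
  intro r hr hrp δ hδ hδ1 t ht htδ f hf hsupp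
  have hMα : M ≤ α.order := by
    refine le_trans ?_ hα
    simp only [MultiIndex.order, Finset.sum_const, Finset.card_univ, Fintype.card_fin, smul_eq_mul]
    nlinarith
  obtain ⟨hmeas, hle⟩ := h α β hMα δ t hδ hδ1 ht f hf hsupp
  refine ⟨hmeas, hle.trans ?_⟩
  gcongr
  rw [show ENNReal.ofReal ((1 + t) ^ b) * C = ENNReal.ofReal ((1 + t) ^ b * C.toReal) by
    rw [ENNReal.ofReal_mul (by positivity), ENNReal.ofReal_toReal hC]]
  refine ENNReal.ofReal_le_ofReal ?_
  have hinv : 1 ≤ 1 / δ := (one_le_div hδ).2 hδ1.le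
  have hpow : (1 + t) ^ b ≤ 2 ^ b * (1 / δ) ^ (4 * ((n : ℝ) / r + 1) * ε) := by
    have h1 : δ ^ (-ε) = (1 / δ) ^ ε := by
      rw [Real.rpow_neg hδ.le, one_div, Real.inv_rpow hδ.le]
    -- Both `1` and `t` are at most `(1 / δ) ^ ε`.
    have h2 : 1 + t ≤ 2 * (1 / δ) ^ ε := by
      have := Real.one_le_rpow hinv hε.le
      linarith
    have h3 : b ≤ 4 * ((n : ℝ) / r + 1) := by
      have : (n : ℝ) / p ≤ n / r := by gcongr
      have h4 : 0 < (n : ℝ) / r := by positivity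
      rw [hb, mul_div_assoc]; linarith
    calc (1 + t) ^ b ≤ (2 * (1 / δ) ^ ε) ^ b := by gcongr
      _ = 2 ^ b * (1 / δ) ^ (b * ε) := by
        rw [Real.mul_rpow (by positivity) (by positivity), ← Real.rpow_mul (by positivity),
          mul_comm ε]
      _ ≤ _ := by gcongr
  calc _ ≤ 2 ^ b * (1 / δ) ^ (4 * ((n : ℝ) / r + 1) * ε) * (C.toReal + 1) := by
        gcongr
        linarith
    _ = _ := by ring
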